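/- Let $x,y,z$ be the coordinates of $\mathbb R^3$ and let $\pi = 2x\,\partial_z\wedge\partial_x-2y\,\partial_z\wedge\partial_y+z\,\partial_x\wedge\partial_y$, i.e. $\{z,x\}=2x$, $\{z,y\}=-2y$, $\{x,y\}=z$. For integers $m,w\ge 0$ let $C^m_w$ be the space of $m$-vector fields on $\mathbb R^3$ whose coefficients are homogeneous polynomials of degree $w$ (the $m$-th cochain space of weight $w$), and let $d=[\pi,\cdot]$, where $[\cdot,\cdot]$ is the Schouten bracket. Then: (1) $\pi$ is, in suitable linear coordinates, the Lie–Poisson structure of $\mathfrak{sp}(\mathbb R^2)$; $[\pi,\pi]=0$, $d(C^m_w)\subseteq C^{m+1}_w$ and $d\circ d=0$. Write $k_m(w)=\dim\ker(d|_{C^m_w})$, and let $b_m(w)$ be the dimension of the cohomology group $\ker(d|_{C^m_w})/d(C^{m-1}_w)$ (with $C^{-1}_w=0$). (2) With $N=\binom{w+2}{2}$, for every $w\ge 0$: $\dim C^0_w=N$, $\dim C^1_w=3N$, $\dim C^2_w=3N$, $\dim C^3_w=N$, and $C^m_w=0$ for $m>3$. (3) If $w$ is odd, then $(k_0,k_1,k_2,k_3)=(0,\,N,\,2N,\,N)$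 and $(b_0,b_1,b_2,b_3)=(0,0,0,0)$. (4) If $w$ is even, then $(k_0,k_1,k_2,k_3)=(1,\,N-1,\,2N+1,\,N)$ and $(b_0,b_1,b_2,b_3)=(1,0,0,1)$. (5) In particular $b_m(w+2)=b_m(w)$ for all $m,w\ge 0$. (6) For $\Omega\ge 0$ put $\varphi(i)=4\Omega+2-4i$ and $\psi(i)=4\Omega-4i$, and let $M=\begin{pmatrix} I & A\\ B& 0\end{pmatrix}$ be the real square matrix of size $2\Omega+1$ in which $I$ is the identity matrix of size $\Omega+1$; $A$ is the $(\Omega+1)\times\Omega$ matrix with diagonal entries $A_{i,i}=-i$ and $A_{i+1,i}=\varphi(i)$ for $1\le i\le\Omega$, all other entries being zero; and $B$ is the $\Omega\times(\Omega+1)$ matrix with $B_{i,i}=\psi(i-1)$ and $B_{i,i+1}=-i$ for $1\le i\le\Omega$, all other entries being zero. Then $$\det M=\Omega!\sum_{j=1}^{\Omega+1}\psi(0)\cdots\psi(j-2)\,\varphi(j)\cdots\varphi(\Omega)$$ (empty products being $1$), and $M$ has full rank $2\Omega+1$. -/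

import Mathlib

open scoped TensorProduct

noncomputable section

namespace PolyPoisson

/-- Multivector fields on `ℝⁿ` with polynomial coefficients, `ℝ[x₁,…,xₙ] ⊗ Λ(ℝⁿ)`, where `ℝⁿ` is
the space of constant vector fields. The wedge product is the multiplication of this algebra. -/
abbrev MultiVec (n : ℕ) : Type :=
  MvPolynomial (Fin n) ℝ ⊗[ℝ] ExteriorAlgebra ℝ (Fin n → ℝ)

/-- A shortcut for instance search. -/
instance (n : ℕ) : AddCommGroup (MultiVec n) := inferInstance

/-- The constant coordinate vector field `∂ᵢ`, as an element of the exterior algebra. -/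
def del {n : ℕ} (i : Fin n) : ExteriorAlgebra ℝ (Fin n → ℝ) :=
  ExteriorAlgebra.ι ℝ (Pi.single i 1)

/-- The coefficientwise partial derivative `f ⊗ u ↦ (∂f/∂xᵢ) ⊗ u`. -/
def coeffDeriv {n : ℕ} (i : Fin n) : MultiVec n →ₗ[ℝ] MultiVec n :=
  LinearMap.rTensor _ (MvPolynomial.pderiv (R := ℝ) i).toLinearMap

/-- Interior product with `dxᵢ` from the left (the left derivative with respect to `∂ᵢ`):
`∂ᵢ ∧ v ↦ v` whenever `v` does not involve `∂ᵢ`. -/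
def contractL {n : ℕ} (i : Fin n) : MultiVec n →ₗ[ℝ] MultiVec n :=
  LinearMap.lTensor _
    (CliffordAlgebra.contractLeft (Q := (0 : QuadraticForm ℝ (Fin n → ℝ)))
      (LinearMap.proj i : (Fin n → ℝ) →ₗ[ℝ] ℝ))

/-- Interior product with `dxᵢ` from the right (the right derivative with respect to `∂ᵢ`):
`v ∧ ∂ᵢ ↦ v` whenever `v` does not involve `∂ᵢ`. -/
def contractR {n : ℕ} (i : Fin n) : MultiVec n →ₗ[ℝ] MultiVec n :=
  LinearMap.lTensor _
    ((CliffordAlgebra.contractRight (Q := (0 : QuadraticForm ℝ (Fin n → ℝ)))).flip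
      (LinearMap.proj i : (Fin n → ℝ) →ₗ[ℝ] ℝ))

/-- The Schouten bracket of polynomial multivector fields,
`[P, Q] = ∑ᵢ (P ⌊ dxᵢ) ∧ ∂Q/∂xᵢ - ∂P/∂xᵢ ∧ (dxᵢ ⌋ Q)`.
It is the biderivation with `[X, f] = X f`, with `[X, Y]` the Lie bracket of vector fields, and
`[P, Q ∧ R] = [P, Q] ∧ R + (-1) ^ ((p + 1) q) Q ∧ [P, R]`,
`[P ∧ Q, R] = P ∧ [Q, R] + (-1) ^ (q (r + 1)) [P, R] ∧ Q` in degrees `p`, `q`, `r`. -/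
def schouten {n : ℕ} : MultiVec n →ₗ[ℝ] MultiVec n →ₗ[ℝ] MultiVec n :=
  ∑ i : Fin n,
    ((LinearMap.mul ℝ (MultiVec n)).compl₁₂ (contractR i) (coeffDeriv i)
      - (LinearMap.mul ℝ (MultiVec n)).compl₁₂ (coeffDeriv i) (contractL i))

/-- `m`-vector fields whose coefficients are homogeneous polynomials of degree `p`. -/
def homogPart (n m p : ℕ) : Submodule ℝ (MultiVec n) :=
  LinearMap.range
    (TensorProduct.mapIncl (MvPolynomial.homogeneousSubmodule (Fin n) ℝ p) (⋀[ℝ]^m (Fin n → ℝ)))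

/-- The `m`-th cochain space of weight `w`, for `h`-homogeneous Poisson structures: the `m`-vector
fields with coefficients homogeneous of degree `p`, where `p - (h - 1) m = w`. -/
def cochain (n h m : ℕ) (w : ℤ) : Submodule ℝ (MultiVec n) :=
  ⨆ p : {p : ℕ // (p : ℤ) - ((h : ℤ) - 1) * (m : ℤ) = w}, homogPart n m p

/-- The kernel of `[π, ·]` in the `m`-th cochain space of weight `w`. -/
def cocycles {n : ℕ} (π : MultiVec n) (h m : ℕ) (w : ℤ) : Submodule ℝ (MultiVec n) :=
  cochain n h m w ⊓ LinearMap.ker (schouten π)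

/-- The image under `[π, ·]` of the cochain space of degree `m - 1` and weight `w`
(zero when `m = 0`). -/
def coboundaries {n : ℕ} (π : MultiVec n) (h : ℕ) : ℕ → ℤ → Submodule ℝ (MultiVec n)
  | 0, _ => ⊥
  | m + 1, w => (cochain n h m w).map (schouten π)

/-- The `m`-th Poisson polynomial cohomology group of weight `w`. -/
abbrev Cohomology {n : ℕ} (π : MultiVec n) (h m : ℕ) (w : ℤ) : Type :=
  cocycles π h m w ⧸ (coboundaries π h m w).submoduleOf (cocycles π h m w)

/-- The `m`-th Betti number of weight `w`. -/
def betti {n : ℕ} (π : MultiVec n) (h m : ℕ) (w : ℤ) : ℕ :=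
  Module.finrank ℝ (Cohomology π h m w)

/-- The Lie–Poisson bivector of a Lie algebra in the linear coordinates given by a basis `b`:
`½ ∑ᵢⱼ {xᵢ, xⱼ} ∂ᵢ ∧ ∂ⱼ` with `{xᵢ, xⱼ} = ∑ₖ cᵢⱼᵏ xₖ`, where `⁅bᵢ, bⱼ⁆ = ∑ₖ cᵢⱼᵏ bₖ`. -/
def liePoisson {n : ℕ} {L : Type*} [LieRing L] [LieAlgebra ℝ L] (b : Module.Basis (Fin n) ℝ L) :
    MultiVec n :=
  (1 / 2 : ℝ) • ∑ i : Fin n, ∑ j : Fin n,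
    (∑ k : Fin n, MvPolynomial.C (b.repr ⁅b i, b j⁆ k) * MvPolynomial.X k) ⊗ₜ[ℝ] (del i * del j)

/-- The `𝔰𝔭(ℝ²)` Lie–Poisson bivector `2x ∂_z ∧ ∂_x - 2y ∂_z ∧ ∂_y + z ∂_x ∧ ∂_y` on `ℝ³`, with
coordinates `x, y, z` numbered `0, 1, 2`. Thus `{z, x} = 2x`, `{z, y} = -2y`, `{x, y} = z`. -/
def spBivector : MultiVec 3 :=
  (2 * MvPolynomial.X 0) ⊗ₜ[ℝ] (del 2 * del 0)
    - (2 * MvPolynomial.X 1) ⊗ₜ[ℝ] (del 2 * del 1)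
    + MvPolynomial.X 2 ⊗ₜ[ℝ] (del 0 * del 1)

/-- `φ(i) = 4Ω + 2 - 4i`. -/
def phi (Ω i : ℕ) : ℝ := 4 * (Ω : ℝ) + 2 - 4 * (i : ℝ)

/-- `ψ(i) = 4Ω - 4i`. -/
def psi (Ω i : ℕ) : ℝ := 4 * (Ω : ℝ) - 4 * (i : ℝ)

/-- The auxiliary square matrix of size `2Ω + 1`, in blocks `[I, A; B, 0]`. With rows and columns
of the blocks numbered from `0`, the `(Ω + 1) × Ω` block `A` has diagonal entries `-(i + 1)` and
subdiagonal entries `φ(i)` in row `i`, and the `Ω × (Ω + 1)` block `B` has diagonal entries `ψ(i)`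
and superdiagonal entries `-(i + 1)` in row `i`. -/
def auxMatrix (Ω : ℕ) : Matrix (Fin (Ω + 1) ⊕ Fin Ω) (Fin (Ω + 1) ⊕ Fin Ω) ℝ :=
  Matrix.fromBlocks 1
    (Matrix.of fun (i : Fin (Ω + 1)) (j : Fin Ω) =>
      if (i : ℕ) = (j : ℕ) then -((i : ℕ) + 1 : ℝ)
      else if (i : ℕ) = (j : ℕ) + 1 then phi Ω i else 0)
    (Matrix.of fun (i : Fin Ω) (j : Fin (Ω + 1)) =>
      if (j : ℕ) = (i : ℕ) then psi Ω i
      else if (j : ℕ) = (i : ℕ) + 1 then -((i : ℕ) + 1 : ℝ) else 0)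
    0

end PolyPoisson

end

noncomputable section

namespace PolyPoisson

/-! ### The `sl₂` action on polynomials in three variables and its Casimir operator. -/

section

open MvPolynomial

/-! The brackets `{x, ·}`, `{y, ·}`, `{z, ·}` are derivations satisfying the `sl₂` relations, and
`[π, ·]` is the Chevalley–Eilenberg differential of `sl₂` with values in the polynomials of degree
`w`. The proof is the classical one by Casimir operator, made explicit.

On degree `w` the Casimir operator equals `2 (w (w + 1) - q Δ)`, where `q = z² + 4xy` and `Δ = ∂x ∂y
+ ∂z²` (`cas_eq`). An equation `cas f = c q^k` therefore forces `q` to divide `f`, and the quotient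
satisfies the same kind of equation two degrees lower. Descending to degree `0` or `1` shows that
the kernel is spanned by `q^(w/2)` for even `w`, is zero for odd `w`, and meets the image trivially.
Hence every polynomial is an invariant plus a value of `cas` (`exists_eq_add_cas`).

In degrees one and two, an explicit homotopy `h` with `d h + h d = cas` takes care of the values of
`cas`, while on triples of invariants `d` is an invertible constant map because `[sl₂, sl₂] = sl₂`
(`exact_one`, `exact_two`). So the middle cohomology vanishes, and rank-nullity computes everything
else from the dimension of the invariants.

The determinant is independent of this: a Schur complement turns it into a tridiagonal determinant,
whose continuant recurrence the claimed sum also satisfies. All terms of that sum are positive,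
which gives full rank. -/

theorem finrank_homogeneousSubmodule (n w : ℕ) :
    Module.finrank ℝ (homogeneousSubmodule (Fin (n + 1)) ℝ w) = (n + w).choose n := by
  rw [homogeneousSubmodule_eq_finsupp_supported]
  rw [AddMonoidAlgebra.supported_eq_map, LinearEquiv.finrank_map_eq]
  rw [(Finsupp.supportedEquivFinsupp (M := ℝ) (R := ℝ)
    {d : Fin (n + 1) →₀ ℕ | d.degree = w}).finrank_eq]
  have e : {d : Fin (n + 1) →₀ ℕ | d.degree = w}
      = ((Finset.univ : Finset (Fin (n + 1))).finsuppAntidiag w : Set _) := by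
    ext d
    simp [Finsupp.degree_eq_sum]
  rw [e, Module.finrank_finsupp_self, Fintype.card_eq_nat_card,
    Nat.card_coe_set_eq, Set.ncard_coe_finset]
  rw [Finset.card_finsuppAntidiag_nat_eq_choose]
  rw [Finset.card_fin, show n + 1 + w - 1 = n + w by omega, Nat.choose_symm_add]

abbrev Poly3 := MvPolynomial (Fin 3) ℝ

theorem C_two : (C 2 : Poly3) = 2 := map_ofNat C 2

theorem C_four : (C 4 : Poly3) = 4 := map_ofNat C 4

theorem pderiv_two (i : Fin 3) : pderiv i (2 : Poly3) = 0 := by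
  rw [← C_two, pderiv_C]

theorem pderiv_four (i : Fin 3) : pderiv i (4 : Poly3) = 0 := by
  rw [← C_four, pderiv_C]


/-- The Hamiltonian derivation `{x, ·}`. -/
def hamX : Derivation ℝ Poly3 Poly3 :=
  (X 2 : Poly3) • pderiv 1 - (2 * X 0 : Poly3) • pderiv 2

/-- The Hamiltonian derivation `{y, ·}`. -/
def hamY : Derivation ℝ Poly3 Poly3 :=
  (2 * X 1 : Poly3) • pderiv 2 - (X 2 : Poly3) • pderiv 0

/-- The Hamiltonian derivation `{z, ·}`. -/
def hamZ : Derivation ℝ Poly3 Poly3 :=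
  (2 * X 0 : Poly3) • pderiv 0 - (2 * X 1 : Poly3) • pderiv 1

theorem hamX_apply (f : Poly3) : hamX f = X 2 * pderiv 1 f - 2 * X 0 * pderiv 2 f := by
  simp [hamX]

theorem hamY_apply (f : Poly3) : hamY f = 2 * X 1 * pderiv 2 f - X 2 * pderiv 0 f := by
  simp [hamY]

theorem hamZ_apply (f : Poly3) : hamZ f = 2 * X 0 * pderiv 0 f - 2 * X 1 * pderiv 1 f := by
  simp [hamZ]

/-- A commutator of derivations is a derivation, so this relation and the next two need checking
only on the three coordinates. -/
theorem hamX_hamY (f : Poly3) : hamX (hamY f) = hamY (hamX f) + hamZ f := by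
  have : ⁅hamX, hamY⁆ = hamZ := by
    refine derivation_ext fun i => ?_
    fin_cases i <;> simp [Derivation.commutator_apply, hamX_apply, hamY_apply, hamZ_apply,
      pderiv_X, Derivation.leibniz, pderiv_two]
    ring
  rw [← this, Derivation.commutator_apply]; ring

theorem hamZ_hamX (f : Poly3) : hamZ (hamX f) = hamX (hamZ f) + 2 * hamX f := by
  have : ⁅hamZ, hamX⁆ = (2 : ℝ) • hamX := by
    refine derivation_ext fun i => ?_
    fin_cases i <;> simp [Derivation.commutator_apply, hamX_apply, hamZ_apply,
      pderiv_X, Derivation.leibniz, smul_eq_C_mul, pderiv_two, C_two] <;> ring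
  have h := congrArg (fun D => D f) this
  simp [Derivation.commutator_apply, smul_eq_C_mul, C_two] at h
  linear_combination h

theorem hamZ_hamY (f : Poly3) : hamZ (hamY f) = hamY (hamZ f) - 2 * hamY f := by
  have : ⁅hamZ, hamY⁆ = (-2 : ℝ) • hamY := by
    refine derivation_ext fun i => ?_
    fin_cases i <;> simp [Derivation.commutator_apply, hamY_apply, hamZ_apply,
      pderiv_X, Derivation.leibniz, smul_eq_C_mul, pderiv_two, C_two]
  have h := congrArg (fun D => D f) this
  simp [Derivation.commutator_apply, smul_eq_C_mul, C_two] at h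
  linear_combination h

/-- The Casimir polynomial `z² + 4xy`. -/
def casimirPoly : Poly3 := X 2 ^ 2 + 4 * X 0 * X 1

theorem casimirPoly_ne_zero : casimirPoly ≠ 0 := by
  intro h
  have := congrArg (eval ![0, 0, 1]) h
  simp [casimirPoly] at this

theorem isHomogeneous_casimirPoly : casimirPoly.IsHomogeneous 2 := by
  refine .add (by simpa using (isHomogeneous_X ℝ (2 : Fin 3)).pow 2) ?_
  have := ((isHomogeneous_X ℝ (0 : Fin 3)).C_mul 4).mul (isHomogeneous_X ℝ (1 : Fin 3))
  rwa [C_four] at this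

theorem hamX_casimirPoly : hamX casimirPoly = 0 := by
  simp [casimirPoly, hamX_apply, pderiv_X, Derivation.leibniz,
    Derivation.leibniz_pow, pderiv_four]; ring

theorem hamY_casimirPoly : hamY casimirPoly = 0 := by
  simp [casimirPoly, hamY_apply, pderiv_X, Derivation.leibniz,
    Derivation.leibniz_pow, pderiv_four]; ring

theorem hamZ_casimirPoly : hamZ casimirPoly = 0 := by
  simp [casimirPoly, hamZ_apply, pderiv_X, Derivation.leibniz,
    Derivation.leibniz_pow, pderiv_four]; ring

/-- The Casimir operator of the action of `𝔰𝔭(ℝ²)` on polynomials. -/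
def cas : Poly3 →ₗ[ℝ] Poly3 :=
  hamX.toLinearMap ∘ₗ hamY.toLinearMap + hamY.toLinearMap ∘ₗ hamX.toLinearMap
    + (1 / 2 : ℝ) • hamZ.toLinearMap ∘ₗ hamZ.toLinearMap

theorem cas_apply (f : Poly3) :
    cas f = hamX (hamY f) + hamY (hamX f) + C (1 / 2) * hamZ (hamZ f) := by
  simp [cas, smul_eq_C_mul]

/-- The Laplacian `∂x ∂y + ∂z²` dual to the Casimir polynomial. -/
def lap (f : Poly3) : Poly3 := pderiv 0 (pderiv 1 f) + pderiv 2 (pderiv 2 f)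

theorem euler {w : ℕ} {f : Poly3} (hf : f.IsHomogeneous w) :
    X 0 * pderiv 0 f + X 1 * pderiv 1 f + X 2 * pderiv 2 f = (w : Poly3) * f := by
  have := hf.sum_X_mul_pderiv
  simpa [Fin.sum_univ_three] using this

/-- The cross terms of the Leibniz rule add up to four times the Euler operator, and `Δ q = 6`. This
commutation rule is what lets the Casimir equation descend from `q g` to `g`. -/
theorem lap_casimirPoly_mul {w : ℕ} {g : Poly3} (hg : g.IsHomogeneous w) :
    lap (casimirPoly * g) = (6 + 4 * w) * g + casimirPoly * lap g := by
  have h := euler hg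
  simp [lap, casimirPoly, pderiv_X, Derivation.leibniz,
    Derivation.leibniz_pow, pderiv_two, pderiv_four]
  linear_combination 4 * h

theorem pderiv_pderiv_comm (i j : Fin 3) (f : Poly3) :
    pderiv i (pderiv j f) = pderiv j (pderiv i f) := by
  have : ⁅pderiv (R := ℝ) i, pderiv j⁆ = (0 : Derivation ℝ Poly3 Poly3) := by
    refine derivation_ext fun k => ?_
    simp only [Derivation.commutator_apply, pderiv_X, Pi.single_apply]
    split_ifs <;> simp
  have h := congrArg (fun D => D f) this
  simpa [Derivation.commutator_apply, sub_eq_zero] using h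

/-- The analogue of writing the angular momentum operator through the Euler operator and `r² Δ`, for
the invariant quadratic form `q`. It turns the study of the Casimir kernel into divisibility by `q`.
-/
theorem cas_eq {w : ℕ} {f : Poly3} (hf : f.IsHomogeneous w) :
    cas f = C 2 * ((w * (w + 1) : Poly3) * f - casimirPoly * lap f) := by
  have h := euler hf
  -- Differentiating Euler's identity once more supplies the second-order terms, namely the square
  -- of the Euler operator.
  have h0 := congrArg (pderiv 0) h
  have h1 := congrArg (pderiv 1) h
  have h2 := congrArg (pderiv 2) h
  have hc : (2 : Poly3) * C (1 / 2) = 1 := by rw [← C_two, ← C_mul]; norm_num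
  simp only [cas_apply, hamX_apply, hamY_apply, hamZ_apply, C_two]
  simp only [pderiv_X, Pi.single_apply, Derivation.leibniz, pderiv_two, map_add, map_sub,
    Derivation.map_natCast, smul_eq_mul, lap, casimirPoly] at h0 h1 h2 ⊢
  simp [pderiv_pderiv_comm 1 0, pderiv_pderiv_comm 2 0, pderiv_pderiv_comm 2 1] at h0 h1 h2 ⊢
  rw [one_div] at hc
  linear_combination 2 * (X 0 * h0 + X 1 * h1 + X 2 * h2) + 2 * (1 + w) * h
    + 2 * (X 0 * (pderiv 0 f + X 0 * pderiv 0 (pderiv 0 f) - X 1 * pderiv 0 (pderiv 1 f))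
      - X 1 * (X 0 * pderiv 0 (pderiv 1 f) - pderiv 1 f - X 1 * pderiv 1 (pderiv 1 f))) * hc

theorem hamX_mem {w : ℕ} {f : Poly3} (hf : f.IsHomogeneous w) : (hamX f).IsHomogeneous w := by
  obtain _ | w := w
  · rw [← mem_homogeneousSubmodule, homogeneousSubmodule_zero] at hf
    obtain ⟨c, rfl⟩ := Submodule.mem_one.mp hf
    simp [isHomogeneous_zero]
  · rw [hamX_apply, mul_assoc, ← C_two, add_comm]
    exact .sub ((isHomogeneous_X ℝ _).mul hf.pderiv)
      (((isHomogeneous_X ℝ _).mul hf.pderiv).C_mul _)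

theorem hamY_mem {w : ℕ} {f : Poly3} (hf : f.IsHomogeneous w) : (hamY f).IsHomogeneous w := by
  obtain _ | w := w
  · rw [← mem_homogeneousSubmodule, homogeneousSubmodule_zero] at hf
    obtain ⟨c, rfl⟩ := Submodule.mem_one.mp hf
    simp [isHomogeneous_zero]
  · rw [hamY_apply, mul_assoc, ← C_two, add_comm]
    exact .sub (((isHomogeneous_X ℝ _).mul hf.pderiv).C_mul _)
      ((isHomogeneous_X ℝ _).mul hf.pderiv)

theorem hamZ_mem {w : ℕ} {f : Poly3} (hf : f.IsHomogeneous w) : (hamZ f).IsHomogeneous w := by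
  obtain _ | w := w
  · rw [← mem_homogeneousSubmodule, homogeneousSubmodule_zero] at hf
    obtain ⟨c, rfl⟩ := Submodule.mem_one.mp hf
    simp [isHomogeneous_zero]
  · rw [hamZ_apply, mul_assoc, mul_assoc, ← C_two, add_comm]
    exact .sub (((isHomogeneous_X ℝ _).mul hf.pderiv).C_mul _)
      (((isHomogeneous_X ℝ _).mul hf.pderiv).C_mul _)

theorem cas_mem {w : ℕ} {f : Poly3} (hf : f.IsHomogeneous w) : (cas f).IsHomogeneous w := by
  rw [cas_apply]
  exact .add (.add (hamX_mem (hamY_mem hf)) (hamY_mem (hamX_mem hf)))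
    ((hamZ_mem (hamZ_mem hf)).C_mul _)

theorem lap_mem {w : ℕ} {f : Poly3} (hf : f.IsHomogeneous (w + 2)) : (lap f).IsHomogeneous w :=
  .add hf.pderiv.pderiv hf.pderiv.pderiv

theorem lap_eq_zero {w : ℕ} {f : Poly3} (hf : f.IsHomogeneous w) (hw : w < 2) : lap f = 0 := by
  have h : ∀ i j : Fin 3, pderiv i (pderiv j f) = 0 := fun i j => by
    have := hf.pderiv (i := j)
    rw [show w - 1 = 0 by omega, ← mem_homogeneousSubmodule, homogeneousSubmodule_zero] at this
    obtain ⟨c, hc⟩ := Submodule.mem_one.mp this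
    rw [← hc]
    exact Derivation.map_algebraMap _ _
  simp [lap, h]

/-- The division step: a solution of the Casimir equation in degree `w + 2` is a multiple of the
Casimir polynomial, and the quotient solves the Casimir equation in degree `w`. -/
theorem exists_eq_casimirPoly_mul {w : ℕ} {f r : Poly3} (hf : f.IsHomogeneous (w + 2))
    (hr : r.IsHomogeneous w)
    (h : ((w + 2) * (w + 3) : Poly3) * f - casimirPoly * lap f = casimirPoly * r) :
    ∃ g : Poly3, g.IsHomogeneous w ∧ f = casimirPoly * g ∧
      ((w * (w + 1) : Poly3) * g - casimirPoly * lap g = r) := by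
  have hne : ((w : ℝ) + 2) * (w + 3) ≠ 0 := by positivity
  have hC : (C ((((w : ℝ) + 2) * (w + 3))⁻¹) : Poly3) * ((w + 2) * (w + 3)) = 1 := by
    have : ((w + 2) * (w + 3) : Poly3) = C (((w : ℝ) + 2) * (w + 3)) := by
      simp [C_two, show (C 3 : Poly3) = 3 from map_ofNat C 3]
    rw [this, ← C_mul, inv_mul_cancel₀ hne, C_1]
  have hg : (C ((((w : ℝ) + 2) * (w + 3))⁻¹) * (lap f + r)).IsHomogeneous w :=
    ((lap_mem hf).add hr).C_mul _
  -- Since `(w + 2)(w + 3)` is a nonzero constant, the equation itself exhibits `f` as `q` times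
  -- this quotient.
  have hfg : f = casimirPoly * (C ((((w : ℝ) + 2) * (w + 3))⁻¹) * (lap f + r)) := by
    linear_combination C ((((w : ℝ) + 2) * (w + 3))⁻¹) * h - f * hC
  refine ⟨_, hg, hfg, mul_left_cancel₀ casimirPoly_ne_zero ?_⟩
  -- Substituting `f = q g`, the coefficient of `q g` becomes `(w + 2)(w + 3) - (6 + 4 w) = w (w +
  -- 1)`.
  generalize C ((((w : ℝ) + 2) * (w + 3))⁻¹) * (lap f + r) = g at hg hfg
  subst hfg
  rw [lap_casimirPoly_mul hg] at h
  linear_combination h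

/-- Each division by `q` preserves the shape of the equation and lowers `k` by one. On constants the
left side is zero, which forces `c = 0`. The right side is allowed to be nonzero in order to show
later that kernel and image of the Casimir operator meet only in zero. -/
theorem casimir_equation_even (k : ℕ) {f : Poly3} {c : ℝ} (hf : f.IsHomogeneous (2 * k))
    (h : (2 * k * (2 * k + 1) : Poly3) * f - casimirPoly * lap f
      = C c * casimirPoly ^ k) :
    c = 0 ∧ ∃ e : ℝ, f = C e * casimirPoly ^ k := by
  induction k generalizing f with
  | zero =>
    rw [lap_eq_zero hf (by omega)] at h
    rw [← mem_homogeneousSubmodule, homogeneousSubmodule_zero] at hf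
    obtain ⟨e, rfl⟩ := Submodule.mem_one.mp hf
    refine ⟨?_, e, by simp⟩
    have : (C c : Poly3) = 0 := by simpa using h.symm
    simpa using this
  | succ k ih =>
    obtain ⟨g, hg, rfl, hg'⟩ := exists_eq_casimirPoly_mul (w := 2 * k) (r := C c * casimirPoly ^ k)
      hf (by simpa using (isHomogeneous_casimirPoly.pow k).C_mul c)
      (by push_cast at h ⊢; linear_combination h)
    obtain ⟨hc, e, rfl⟩ := ih hg (by push_cast at hg'; linear_combination hg')
    exact ⟨hc, e, by ring⟩

/-- The same descent ends in degree one, where `Δ` vanishes and the left side is `2 f`. -/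
theorem casimir_equation_odd (k : ℕ) {f : Poly3} (hf : f.IsHomogeneous (2 * k + 1))
    (h : ((2 * k + 1) * (2 * k + 2) : Poly3) * f - casimirPoly * lap f = 0) :
    f = 0 := by
  induction k generalizing f with
  | zero =>
    rw [lap_eq_zero hf (by omega)] at h
    have : (C 2 : Poly3) * f = 0 := by rw [C_two]; linear_combination h
    simpa using this
  | succ k ih =>
    obtain ⟨g, hg, rfl, hg'⟩ := exists_eq_casimirPoly_mul (w := 2 * k + 1) (r := 0)
      hf (isHomogeneous_zero _ _ _) (by push_cast at h ⊢; linear_combination h)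
    rw [ih hg (by push_cast at hg'; linear_combination hg'), mul_zero]

theorem cas_eq_even {k : ℕ} {f : Poly3} {c : ℝ} (hf : f.IsHomogeneous (2 * k))
    (h : cas f = C c * casimirPoly ^ k) : c = 0 ∧ ∃ e : ℝ, f = C e * casimirPoly ^ k := by
  rw [cas_eq hf] at h
  push_cast at h
  have hc : (C 2⁻¹ : Poly3) * C 2 = 1 := by rw [← C_mul]; simp
  have := casimir_equation_even (c := 2⁻¹ * c) k hf
    (by rw [C_mul]; linear_combination C 2⁻¹ * h - ((2 * k * (2 * k + 1) : Poly3) * f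
          - casimirPoly * lap f) * hc)
  simpa using this

theorem eq_zero_of_cas_eq_zero_odd {k : ℕ} {f : Poly3} (hf : f.IsHomogeneous (2 * k + 1))
    (h : cas f = 0) : f = 0 := by
  rw [cas_eq hf] at h
  refine casimir_equation_odd k hf ?_
  have := (mul_eq_zero.mp h).resolve_left (by simp)
  push_cast at this
  linear_combination this

theorem ham_casimirPoly_pow (D : Derivation ℝ Poly3 Poly3) (hD : D casimirPoly = 0) (k : ℕ)
    (e : ℝ) : D (C e * casimirPoly ^ k) = 0 := by
  simp [Derivation.leibniz, Derivation.leibniz_pow, hD]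

/-- Homogeneous polynomials in the kernel of the Casimir operator are invariant. -/
theorem ham_eq_zero_of_cas_eq_zero {w : ℕ} {f : Poly3} (hf : f.IsHomogeneous w) (h : cas f = 0) :
    hamX f = 0 ∧ hamY f = 0 ∧ hamZ f = 0 := by
  obtain ⟨k, rfl | rfl⟩ := Nat.even_or_odd' w
  · obtain ⟨-, e, rfl⟩ := cas_eq_even (c := 0) hf (by simpa using h)
    exact ⟨ham_casimirPoly_pow _ hamX_casimirPoly _ _, ham_casimirPoly_pow _ hamY_casimirPoly _ _,
      ham_casimirPoly_pow _ hamZ_casimirPoly _ _⟩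
  · simp [eq_zero_of_cas_eq_zero_odd hf h]

theorem cas_eq_zero_of_ham_eq_zero {f : Poly3} (hx : hamX f = 0) (hy : hamY f = 0)
    (hz : hamZ f = 0) : cas f = 0 := by
  simp [cas_apply, hx, hy, hz]

/-- Semisimplicity at the eigenvalue zero: in even degree `cas f` lies in the kernel, so it is a
multiple of a power of `q`, and no nonzero multiple is a value of `cas`. -/
theorem cas_eq_zero_of_cas_cas_eq_zero {w : ℕ} {f : Poly3} (hf : f.IsHomogeneous w)
    (h : cas (cas f) = 0) : cas f = 0 := by
  obtain ⟨k, rfl | rfl⟩ := Nat.even_or_odd' w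
  · obtain ⟨-, e, he⟩ := cas_eq_even (c := 0) (cas_mem hf) (by simpa using h)
    rw [he, (cas_eq_even hf he).1]
    simp
  · exact eq_zero_of_cas_eq_zero_odd (cas_mem hf) h

/-- The Casimir operator on homogeneous polynomials. -/
def casHom (w : ℕ) : homogeneousSubmodule (Fin 3) ℝ w →ₗ[ℝ] homogeneousSubmodule (Fin 3) ℝ w :=
  cas.restrict fun _ hf => cas_mem hf

instance (w : ℕ) : Module.Finite ℝ (homogeneousSubmodule (Fin 3) ℝ w) :=
  Module.Finite.of_fg (homogeneousSubmodule_fg _ _ _)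

/-- Kernel and image of an endomorphism of a finite-dimensional space have complementary dimensions,
so their being disjoint already makes them span. -/
theorem exists_eq_add_cas {w : ℕ} {f : Poly3} (hf : f.IsHomogeneous w) :
    ∃ f₀ g : Poly3, f₀.IsHomogeneous w ∧ g.IsHomogeneous w ∧ cas f₀ = 0 ∧ f = f₀ + cas g := by
  have hd : Disjoint (LinearMap.ker (casHom w)) (LinearMap.range (casHom w)) := by
    rw [Submodule.disjoint_def]
    rintro _ h ⟨g, rfl⟩
    have := cas_eq_zero_of_cas_cas_eq_zero g.2 (congrArg Subtype.val (LinearMap.mem_ker.mp h))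
    exact Subtype.ext this
  have ht : LinearMap.ker (casHom w) ⊔ LinearMap.range (casHom w) = ⊤ := by
    apply Submodule.eq_top_of_disjoint _ _ _ hd
    rw [add_comm, LinearMap.finrank_range_add_finrank_ker]
  obtain ⟨f₀, h₀, _, ⟨g, rfl⟩, h⟩ := Submodule.mem_sup.mp
    (ht ▸ Submodule.mem_top : (⟨f, hf⟩ : homogeneousSubmodule (Fin 3) ℝ w) ∈ _)
  exact ⟨f₀, g, f₀.2, g.2, congrArg Subtype.val (LinearMap.mem_ker.mp h₀),
    (congrArg Subtype.val h).symm⟩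

end

/-! ### The determinant and rank of the auxiliary matrix. -/

/-- The `n × n` tridiagonal matrix with the given diagonal, superdiagonal and subdiagonal. -/
def tridiagonal (a b c : ℕ → ℝ) (n : ℕ) : Matrix (Fin n) (Fin n) ℝ :=
  Matrix.of fun i j =>
    if (i : ℕ) = j then a i else if (j : ℕ) = i + 1 then b i else if (i : ℕ) = j + 1 then c j else 0

/-- The continuant recurrence, by expansion along the last row and then, in the minor of the
off-diagonal entry, along the last column. -/
theorem det_tridiagonal (a b c : ℕ → ℝ) (n : ℕ) :
    (tridiagonal a b c (n + 2)).det
      = a (n + 1) * (tridiagonal a b c (n + 1)).det - b n * c n * (tridiagonal a b c n).det := by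
  have hz : ∀ i : Fin n, tridiagonal a b c (n + 2) (Fin.last (n + 1)) i.castSucc.castSucc = 0 := by
    intro i
    have := i.2
    simp only [tridiagonal, Matrix.of_apply, Fin.val_last, Fin.val_castSucc]
    rw [if_neg (by omega), if_neg (by omega), if_neg (by omega)]
  rw [Matrix.det_succ_row _ (Fin.last (n + 1)), Fin.sum_univ_castSucc, Fin.sum_univ_castSucc]
  simp only [hz, mul_zero, zero_mul, Finset.sum_const_zero, zero_add]
  have h1 : (tridiagonal a b c (n + 2)).submatrix (Fin.last (n + 1)).succAbove
      (Fin.last (n + 1)).succAbove = tridiagonal a b c (n + 1) := by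
    ext i j
    simp [tridiagonal]
  have h2 : ((tridiagonal a b c (n + 2)).submatrix (Fin.last (n + 1)).succAbove
      (Fin.last n).castSucc.succAbove).det = b n * (tridiagonal a b c n).det := by
    rw [Matrix.det_succ_column _ (Fin.last n), Fin.sum_univ_castSucc]
    have hs : (Fin.last n).castSucc.succAbove (Fin.last n) = Fin.last (n + 1) := by
      rw [Fin.succAbove_castSucc_self]; rfl
    have hz : ∀ i : Fin n, (tridiagonal a b c (n + 2)).submatrix (Fin.last (n + 1)).succAbove
      (Fin.last n).castSucc.succAbove i.castSucc (Fin.last n) = 0 := by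
      intro i
      have := i.2
      simp only [Matrix.submatrix_apply, hs, Fin.succAbove_last]
      simp only [tridiagonal, Matrix.of_apply, Fin.val_last, Fin.val_castSucc]
      rw [if_neg (by omega), if_neg (by omega), if_neg (by omega)]
    simp only [hz, mul_zero, zero_mul, Finset.sum_const_zero, zero_add]
    have h3 : ((tridiagonal a b c (n + 2)).submatrix (Fin.last (n + 1)).succAbove
        (Fin.last n).castSucc.succAbove).submatrix (Fin.last n).succAbove (Fin.last n).succAbove
          = tridiagonal a b c n := by
      ext i j
      have h4 : (Fin.last n).castSucc.succAbove j.castSucc = j.castSucc.castSucc :=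
        Fin.succAbove_castSucc_of_lt _ _ (Fin.castSucc_lt_last j)
      simp [tridiagonal, h4]
    rw [h3, Matrix.submatrix_apply, hs, Fin.succAbove_last]
    simp [tridiagonal, ← two_mul, pow_mul]
  rw [h1, h2]
  have h5 : tridiagonal a b c (n + 2) (Fin.last (n + 1)) (Fin.last n).castSucc = c n := by
    simp only [tridiagonal, Matrix.of_apply, Fin.val_last, Fin.val_castSucc]
    rw [if_neg (by omega), if_neg (by omega), if_pos trivial]
  have h6 : tridiagonal a b c (n + 2) (Fin.last (n + 1)) (Fin.last (n + 1)) = a (n + 1) := by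
    simp [tridiagonal]
  rw [h5, h6]
  have h7 : (-1 : ℝ) ^ (((Fin.last (n + 1) : Fin (n + 2)) : ℕ) + ((Fin.last n).castSucc : Fin (n + 2)))
      = -1 := by
    simp only [Fin.val_last, Fin.val_castSucc]
    exact Odd.neg_one_pow ⟨n, by ring⟩
  have h8 : (-1 : ℝ) ^ (((Fin.last (n + 1) : Fin (n + 2)) : ℕ) + (Fin.last (n + 1) : Fin (n + 2)))
      = 1 := Even.neg_one_pow ⟨_, rfl⟩
  rw [h7, h8]
  ring

/-- The sum `∑ⱼ ψ(0)⋯ψ(j-2) φ(j)⋯φ(n)` over `1 ≤ j ≤ n + 1`. -/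
def splitSum (φ ψ : ℕ → ℝ) (n : ℕ) : ℝ :=
  ∑ j ∈ Finset.Icc 1 (n + 1), (∏ i ∈ Finset.range (j - 1), ψ i) * ∏ i ∈ Finset.Icc j n, φ i

theorem splitSum_succ (φ ψ : ℕ → ℝ) (n : ℕ) :
    splitSum φ ψ (n + 1) = φ (n + 1) * splitSum φ ψ n + ∏ i ∈ Finset.range (n + 1), ψ i := by
  unfold splitSum
  rw [Finset.sum_Icc_succ_top (by omega), Finset.mul_sum]
  congr 1
  · refine Finset.sum_congr rfl fun j hj => ?_
    rw [Finset.prod_Icc_succ_top (by simp at hj; omega)]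
    ring
  · simp

/-- Both sides satisfy the continuant recurrence. The sequences are arbitrary because `phi Ω` and
`psi Ω` depend on `Ω`: induction on the size requires keeping them fixed while the size varies. -/
theorem det_tridiagonal_eq_splitSum (φ ψ : ℕ → ℝ) (n : ℕ) :
    (tridiagonal (fun i => (i + 1) * (ψ i + φ (i + 1))) (fun i => -((i + 1) * (i + 2)))
      (fun i => -(ψ (i + 1) * φ (i + 1))) n).det = n.factorial * splitSum φ ψ n := by
  induction n using Nat.twoStepInduction with
  | zero => simp [splitSum]
  | one =>
    rw [splitSum_succ]
    simp [splitSum, tridiagonal, add_comm]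
  | more n h0 h1 =>
    rw [det_tridiagonal, h0, h1, splitSum_succ φ ψ (n + 1), splitSum_succ φ ψ n,
      Finset.prod_range_succ _ (n + 1), Nat.factorial_succ (n + 1), Nat.factorial_succ n]
    push_cast
    ring

theorem auxMatrix_det (Ω : ℕ) :
    (auxMatrix Ω).det = (Ω.factorial : ℝ) * splitSum (phi Ω) (psi Ω) Ω := by
  -- With the identity block eliminated, the determinant is that of `-BA`. Row `i` of `B` is
  -- supported in columns `i` and `i + 1`, so each entry of the product has at most two terms.
  rw [auxMatrix, Matrix.det_fromBlocks_one₁₁, ← det_tridiagonal_eq_splitSum, zero_sub]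
  congr 1
  ext i j
  rw [Matrix.neg_apply, Matrix.mul_apply, Finset.sum_eq_add (i.castSucc) (i.succ)
    (by simp [Fin.ext_iff])]
  · have hi := i.2
    have hj := j.2
    simp only [tridiagonal, Matrix.of_apply, Fin.val_castSucc, Fin.val_succ, if_true]
    rcases lt_trichotomy (i : ℕ) j with h | h | h
    · by_cases h' : (j : ℕ) = i + 1
      · rw [if_neg (by omega), if_neg (by omega), if_neg (by omega), if_pos h'.symm, if_neg h.ne,
          if_pos h']
        push_cast
        ring
      · simp [h.ne, h', Ne.symm h', show (i : ℕ) ≠ j + 1 by omega]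
    · rw [← h]
      simp
      ring
    · by_cases h' : (i : ℕ) = j + 1
      · rw [if_neg (by omega), if_pos h', if_neg (by omega), if_neg (by omega), if_neg (by omega),
          if_neg (by omega), if_neg (by omega), if_pos h', h']
        ring
      · simp [h.ne', h', show (j : ℕ) ≠ i + 1 by omega, show (i : ℕ) + 1 ≠ j by omega]
  · intro k _ hk
    simp only [Matrix.of_apply]
    rw [if_neg, if_neg, zero_mul]
    · exact fun h => hk.2 (Fin.ext h)
    · exact fun h => hk.1 (Fin.ext h)
  · simp
  · simp

theorem splitSum_pos {φ ψ : ℕ → ℝ} {n : ℕ} (hφ : ∀ i ≤ n, 0 < φ i) (hψ : ∀ i < n, 0 < ψ i) :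
    0 < splitSum φ ψ n := by
  refine Finset.sum_pos (fun j hj => mul_pos (Finset.prod_pos fun i hi => hψ i ?_)
    (Finset.prod_pos fun i hi => hφ i ?_)) ⟨1, by simp⟩
  · simp at hi hj; omega
  · simp at hi hj; omega

theorem auxMatrix_rank (Ω : ℕ) : (auxMatrix Ω).rank = 2 * Ω + 1 := by
  have h : IsUnit (auxMatrix Ω) := by
    rw [Matrix.isUnit_iff_isUnit_det, auxMatrix_det, isUnit_iff_ne_zero]
    refine (mul_pos (by positivity) (splitSum_pos (fun i hi => ?_) fun i hi => ?_)).ne'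
    · have : (i : ℝ) ≤ Ω := by exact_mod_cast hi
      unfold phi; linarith
    · have : (i : ℝ) < Ω := by exact_mod_cast hi
      unfold psi; linarith
  rw [Matrix.rank_of_isUnit _ h]
  simp; ring

/-! ### Multivector fields on three-space and the differential in components. -/

section

open MvPolynomial

abbrev Ext3 := ExteriorAlgebra ℝ (Fin 3 → ℝ)

theorem del_mul_self (i : Fin 3) : del i * del i = 0 := ExteriorAlgebra.ι_sq_zero _

theorem del_mul_comm (i j : Fin 3) : del i * del j = -(del j * del i) :=
  eq_neg_of_add_eq_zero_left (ExteriorAlgebra.ι_add_mul_swap _ _)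

theorem del_mul_self_assoc (i : Fin 3) (u : Ext3) : del i * (del i * u) = 0 := by
  rw [← mul_assoc, del_mul_self, zero_mul]

theorem del_mul_comm_assoc (i j : Fin 3) (u : Ext3) :
    del i * (del j * u) = -(del j * (del i * u)) := by
  rw [← mul_assoc, del_mul_comm, neg_mul, mul_assoc]

/-- Left contraction of constant multivectors with `dxᵢ`. -/
def extContractL (i : Fin 3) : Ext3 →ₗ[ℝ] Ext3 :=
  CliffordAlgebra.contractLeft (Q := (0 : QuadraticForm ℝ (Fin 3 → ℝ)))
    (LinearMap.proj i : (Fin 3 → ℝ) →ₗ[ℝ] ℝ)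

/-- Right contraction of constant multivectors with `dxᵢ`. -/
def extContractR (i : Fin 3) : Ext3 →ₗ[ℝ] Ext3 :=
  (CliffordAlgebra.contractRight (Q := (0 : QuadraticForm ℝ (Fin 3 → ℝ)))).flip
    (LinearMap.proj i : (Fin 3 → ℝ) →ₗ[ℝ] ℝ)

theorem extContractL_one (i : Fin 3) : extContractL i 1 = 0 :=
  CliffordAlgebra.contractLeft_one _ _

theorem extContractL_del_mul (i j : Fin 3) (u : Ext3) :
    extContractL i (del j * u) = (if i = j then u else 0) - del j * extContractL i u := by
  refine (CliffordAlgebra.contractLeft_ι_mul _ _ _).trans ?_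
  simp only [LinearMap.proj_apply, Pi.single_apply, ite_smul, one_smul, zero_smul]
  rfl

theorem extContractL_del (i j : Fin 3) : extContractL i (del j) = if i = j then 1 else 0 := by
  simpa [extContractL_one] using extContractL_del_mul i j 1

theorem extContractR_one (i : Fin 3) : extContractR i 1 = 0 :=
  CliffordAlgebra.contractRight_one _ _

theorem extContractR_mul_del (i j : Fin 3) (u : Ext3) :
    extContractR i (u * del j) = (if i = j then u else 0) - extContractR i u * del j := by
  refine (CliffordAlgebra.contractRight_mul_ι _ _ _).trans ?_
  simp only [LinearMap.proj_apply, Pi.single_apply, ite_smul, one_smul, zero_smul]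
  rfl

theorem extContractR_del (i j : Fin 3) : extContractR i (del j) = if i = j then 1 else 0 := by
  simpa [extContractR_one] using extContractR_mul_del i j 1

theorem contractL_tmul (i : Fin 3) (f : Poly3) (u : Ext3) :
    contractL i (f ⊗ₜ[ℝ] u) = f ⊗ₜ[ℝ] extContractL i u := rfl

theorem contractR_tmul (i : Fin 3) (f : Poly3) (u : Ext3) :
    contractR i (f ⊗ₜ[ℝ] u) = f ⊗ₜ[ℝ] extContractR i u := rfl

theorem coeffDeriv_tmul (i : Fin 3) (f : Poly3) (u : Ext3) :
    coeffDeriv i (f ⊗ₜ[ℝ] u) = (pderiv i f) ⊗ₜ[ℝ] u := rfl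

theorem schouten_apply (P Q : MultiVec 3) : schouten P Q =
    ∑ i : Fin 3, (contractR i P * coeffDeriv i Q - coeffDeriv i P * contractL i Q) := by
  simp [schouten, LinearMap.sum_apply]

theorem multiVec_neg_mul (P Q : MultiVec 3) : -P * Q = -(P * Q) :=
  LinearMap.map_neg₂ (LinearMap.mul ℝ (MultiVec 3)) P Q

/-- The differential `[π, ·]` in terms of the action of the Hamiltonian derivations. -/
theorem schouten_spBivector_tmul (f : Poly3) (u : Ext3) :
    schouten spBivector (f ⊗ₜ[ℝ] u) =
      hamX f ⊗ₜ[ℝ] (del 0 * u) + hamY f ⊗ₜ[ℝ] (del 1 * u) + hamZ f ⊗ₜ[ℝ] (del 2 * u)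
        - (2 * f) ⊗ₜ[ℝ] (del 2 * del 0 * extContractL 0 u)
        + (2 * f) ⊗ₜ[ℝ] (del 2 * del 1 * extContractL 1 u)
        - f ⊗ₜ[ℝ] (del 0 * del 1 * extContractL 2 u) := by
  rw [schouten_apply, Fin.sum_univ_three]
  simp only [spBivector, map_add, map_sub, contractL_tmul, contractR_tmul, coeffDeriv_tmul,
    extContractR_mul_del, extContractR_del, Derivation.leibniz, pderiv_two, pderiv_X,
    Pi.single_apply, smul_eq_mul, hamX_apply, hamY_apply, hamZ_apply]
  simp [multiVec_neg_mul, add_mul, TensorProduct.sub_tmul,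
    TensorProduct.tmul_neg]
  abel

/-- The coefficient of `1`. -/
def constCoeff : MultiVec 3 →ₗ[ℝ] Poly3 :=
  (TensorProduct.rid ℝ Poly3).toLinearMap ∘ₗ
    LinearMap.lTensor _ (ExteriorAlgebra.algebraMapInv (R := ℝ) (M := Fin 3 → ℝ)).toLinearMap

theorem constCoeff_tmul_one (f : Poly3) : constCoeff (f ⊗ₜ[ℝ] 1) = f := by
  simp [constCoeff]

/-- Multiplication of a constant multivector by polynomials. -/
def tmulRight (u : Ext3) : Poly3 →ₗ[ℝ] MultiVec 3 := (TensorProduct.mk ℝ Poly3 Ext3).flip u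

/-- Polynomials as multivector fields. -/
def fun0 : Poly3 →ₗ[ℝ] MultiVec 3 := tmulRight 1

/-- The vector field with the given components. -/
def vec1 : Poly3 × Poly3 × Poly3 →ₗ[ℝ] MultiVec 3 :=
  (tmulRight (del 0)).coprod ((tmulRight (del 1)).coprod (tmulRight (del 2)))

/-- The bivector field with the given components in the basis `∂y∧∂z, ∂z∧∂x, ∂x∧∂y`. -/
def vec2 : Poly3 × Poly3 × Poly3 →ₗ[ℝ] MultiVec 3 :=
  (tmulRight (del 1 * del 2)).coprod
    ((tmulRight (del 2 * del 0)).coprod (tmulRight (del 0 * del 1)))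

/-- The trivector field with the given component. -/
def vec3 : Poly3 →ₗ[ℝ] MultiVec 3 := tmulRight (del 0 * (del 1 * del 2))

theorem fun0_apply (f : Poly3) : fun0 f = f ⊗ₜ[ℝ] 1 := rfl

theorem vec1_apply (a b c : Poly3) :
    vec1 (a, b, c) = a ⊗ₜ[ℝ] del 0 + (b ⊗ₜ[ℝ] del 1 + c ⊗ₜ[ℝ] del 2) := rfl

theorem vec2_apply (a b c : Poly3) :
    vec2 (a, b, c) = a ⊗ₜ[ℝ] (del 1 * del 2) + (b ⊗ₜ[ℝ] (del 2 * del 0)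
      + c ⊗ₜ[ℝ] (del 0 * del 1)) := rfl

theorem vec3_apply (f : Poly3) : vec3 f = f ⊗ₜ[ℝ] (del 0 * (del 1 * del 2)) := rfl

theorem constCoeff_fun0 (f : Poly3) : constCoeff (fun0 f) = f := constCoeff_tmul_one f

/-- Contractions followed by the coefficient of `1` recover the components. These left inverses give
injectivity here and in the other degrees without a basis of the exterior algebra. -/
theorem constCoeff_contractL_vec1 (a b c : Poly3) :
    constCoeff (contractL 0 (vec1 (a, b, c))) = a ∧
    constCoeff (contractL 1 (vec1 (a, b, c))) = b ∧
    constCoeff (contractL 2 (vec1 (a, b, c))) = c := by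
  simp [vec1_apply, contractL_tmul, extContractL_del, constCoeff_tmul_one]

theorem constCoeff_contractL_vec2 (a b c : Poly3) :
    constCoeff (contractL 2 (contractL 1 (vec2 (a, b, c)))) = a ∧
    constCoeff (contractL 0 (contractL 2 (vec2 (a, b, c)))) = b ∧
    constCoeff (contractL 1 (contractL 0 (vec2 (a, b, c)))) = c := by
  simp [vec2_apply, contractL_tmul, extContractL_del, extContractL_del_mul, constCoeff_tmul_one]

theorem constCoeff_contractL_vec3 (f : Poly3) :
    constCoeff (contractL 2 (contractL 1 (contractL 0 (vec3 f)))) = f := by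
  simp [vec3_apply, contractL_tmul, extContractL_del, extContractL_del_mul, constCoeff_tmul_one]

theorem fun0_injective : Function.Injective fun0 :=
  Function.LeftInverse.injective constCoeff_fun0

theorem vec1_injective : Function.Injective vec1 := by
  rintro ⟨a, b, c⟩ ⟨a', b', c'⟩ h
  have h1 := constCoeff_contractL_vec1 a b c
  rw [h] at h1
  have h2 := constCoeff_contractL_vec1 a' b' c'
  rw [← h1.1, ← h1.2.1, ← h1.2.2, h2.1, h2.2.1, h2.2.2]

theorem vec2_injective : Function.Injective vec2 := by
  rintro ⟨a, b, c⟩ ⟨a', b', c'⟩ h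
  have h1 := constCoeff_contractL_vec2 a b c
  rw [h] at h1
  have h2 := constCoeff_contractL_vec2 a' b' c'
  rw [← h1.1, ← h1.2.1, ← h1.2.2, h2.1, h2.2.1, h2.2.2]

theorem vec3_injective : Function.Injective vec3 :=
  fun f g h => by
  rw [← constCoeff_contractL_vec3 f, h, constCoeff_contractL_vec3]

theorem schouten_fun0 (f : Poly3) :
    schouten spBivector (fun0 f) = vec1 (hamX f, hamY f, hamZ f) := by
  simp [fun0_apply, vec1_apply, schouten_spBivector_tmul, extContractL_one, add_assoc]

/-- The Chevalley–Eilenberg formula: the derivative terms come from the action, the terms `-2b`,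
`-2a`, `-c` from the bracket of the Lie algebra. -/
theorem schouten_vec1 (a b c : Poly3) :
    schouten spBivector (vec1 (a, b, c)) =
      vec2 (hamY c - hamZ b - 2 * b, hamZ a - hamX c - 2 * a, hamX b - hamY a - c) := by
  simp [vec1_apply, vec2_apply, schouten_spBivector_tmul, extContractL_del, del_mul_self,
    TensorProduct.sub_tmul, del_mul_comm 2 1, del_mul_comm 0 2, del_mul_comm 1 0,
    TensorProduct.tmul_neg]
  abel

theorem schouten_vec2 (a b c : Poly3) :
    schouten spBivector (vec2 (a, b, c)) = vec3 (hamX a + hamY b + hamZ c) := by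
  simp [vec2_apply, vec3_apply, schouten_spBivector_tmul, extContractL_del_mul, extContractL_del,
    mul_assoc, del_mul_self, del_mul_comm 2 1, del_mul_comm 2 0, del_mul_comm 1 0,
    del_mul_comm_assoc 2 1, del_mul_comm_assoc 2 0, del_mul_comm_assoc 1 0, del_mul_self_assoc,
    TensorProduct.tmul_neg, TensorProduct.add_tmul, mul_neg]
  abel

theorem schouten_vec3 (f : Poly3) : schouten spBivector (vec3 f) = 0 := by
  simp [vec3_apply, schouten_spBivector_tmul, extContractL_del_mul, extContractL_del,
    mul_assoc, del_mul_self, del_mul_comm 2 1, del_mul_comm 2 0,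
    del_mul_comm_assoc 2 1, del_mul_comm_assoc 2 0, del_mul_comm_assoc 1 0, del_mul_self_assoc,
    mul_neg]

theorem spBivector_eq : spBivector = vec2 (2 * X 1, 2 * X 0, X 2) := by
  simp [spBivector, vec2_apply, del_mul_comm 2 1, TensorProduct.tmul_neg]
  abel

theorem schouten_self : schouten spBivector spBivector = 0 := by
  have h : hamX (2 * X 1) + hamY (2 * X 0) + hamZ (X 2) = 0 := by
    simp [hamX_apply, hamY_apply, hamZ_apply, pderiv_two, pderiv_X]
  rw [← map_zero vec3, ← h, ← schouten_vec2, ← spBivector_eq]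

/-- The three components of `d²` on functions are exactly the three commutation relations. -/
theorem schouten_schouten_fun0 (f : Poly3) :
    schouten spBivector (schouten spBivector (fun0 f)) = 0 := by
  rw [schouten_fun0, schouten_vec1, ← map_zero vec2]
  congr 1
  refine Prod.ext ?_ (Prod.ext ?_ ?_) <;> simp only [Prod.fst_zero, Prod.snd_zero]
  · linear_combination -hamZ_hamY f
  · linear_combination hamZ_hamX f
  · linear_combination hamX_hamY f

theorem schouten_schouten_vec1 (a b c : Poly3) :
    schouten spBivector (schouten spBivector (vec1 (a, b, c))) = 0 := by
  rw [schouten_vec1, schouten_vec2, ← map_zero vec3]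
  congr 1
  simp only [map_sub, two_mul, map_add]
  linear_combination hamX_hamY c - hamZ_hamY a + hamZ_hamX b

theorem schouten_schouten_vec2 (a b c : Poly3) :
    schouten spBivector (schouten spBivector (vec2 (a, b, c))) = 0 := by
  rw [schouten_vec2, schouten_vec3]

theorem ι_eq (v : Fin 3 → ℝ) :
    ExteriorAlgebra.ι ℝ v = v 0 • del 0 + v 1 • del 1 + v 2 • del 2 := by
  simp only [del, ← map_smul, ← map_add]
  congr 1
  ext i
  fin_cases i <;> simp

theorem exists_of_mem_extPow_one {u : Ext3} (hu : u ∈ ⋀[ℝ]^1 (Fin 3 → ℝ)) :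
    ∃ a b c : ℝ, u = a • del 0 + b • del 1 + c • del 2 := by
  rw [ExteriorAlgebra.exteriorPower, pow_one] at hu
  obtain ⟨v, rfl⟩ := hu
  exact ⟨_, _, _, ι_eq v⟩

theorem del_mem (i : Fin 3) : (del i : Ext3) ∈ ⋀[ℝ]^1 (Fin 3 → ℝ) := by
  rw [ExteriorAlgebra.exteriorPower, pow_one]
  exact ⟨_, rfl⟩

theorem extPow_succ (m : ℕ) :
    ⋀[ℝ]^(m + 1) (Fin 3 → ℝ) = ⋀[ℝ]^1 (Fin 3 → ℝ) * ⋀[ℝ]^m (Fin 3 → ℝ) := by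
  simp only [ExteriorAlgebra.exteriorPower]
  rw [pow_succ', pow_one]

theorem exists_of_mem_extPow_two {u : Ext3} (hu : u ∈ ⋀[ℝ]^2 (Fin 3 → ℝ)) :
    ∃ a b c : ℝ, u = a • (del 1 * del 2) + b • (del 2 * del 0) + c • (del 0 * del 1) := by
  rw [extPow_succ] at hu
  induction hu using Submodule.mul_induction_on' with
  | mem_mul_mem x hx y hy =>
    obtain ⟨a, b, c, rfl⟩ := exists_of_mem_extPow_one hx
    obtain ⟨a', b', c', rfl⟩ := exists_of_mem_extPow_one hy
    refine ⟨b * c' - c * b', c * a' - a * c', a * b' - b * a', ?_⟩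
    simp only [add_mul, mul_add, smul_mul_smul_comm, del_mul_self, del_mul_comm 2 1,
      del_mul_comm 0 2, del_mul_comm 1 0]
    module
  | add x _ y _ hx hy =>
    obtain ⟨a, b, c, rfl⟩ := hx
    obtain ⟨a', b', c', rfl⟩ := hy
    exact ⟨a + a', b + b', c + c', by module⟩

theorem exists_of_mem_extPow_three {u : Ext3} (hu : u ∈ ⋀[ℝ]^3 (Fin 3 → ℝ)) :
    ∃ a : ℝ, u = a • (del 0 * (del 1 * del 2)) := by
  rw [extPow_succ] at hu
  induction hu using Submodule.mul_induction_on' with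
  | mem_mul_mem x hx y hy =>
    obtain ⟨a, b, c, rfl⟩ := exists_of_mem_extPow_one hx
    obtain ⟨a', b', c', rfl⟩ := exists_of_mem_extPow_two hy
    refine ⟨a * a' + b * b' + c * c', ?_⟩
    simp only [add_mul, mul_add, smul_mul_smul_comm, del_mul_self, del_mul_comm 2 1,
      del_mul_comm 2 0, del_mul_comm_assoc 2 1, del_mul_comm_assoc 2 0,
      del_mul_comm_assoc 1 0, del_mul_self_assoc, mul_neg, neg_neg, mul_zero]
    module
  | add x _ y _ hx hy =>
    obtain ⟨a, rfl⟩ := hx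
    obtain ⟨a', rfl⟩ := hy
    exact ⟨a + a', by module⟩

theorem extPow_eq_bot {m : ℕ} (hm : 3 < m) : ⋀[ℝ]^m (Fin 3 → ℝ) = ⊥ := by
  induction m, hm using Nat.le_induction with
  | base =>
    rw [eq_bot_iff, extPow_succ, Submodule.mul_le]
    intro x hx y hy
    obtain ⟨a, b, c, rfl⟩ := exists_of_mem_extPow_one hx
    obtain ⟨a', rfl⟩ := exists_of_mem_extPow_three hy
    simp only [add_mul, smul_mul_smul_comm, del_mul_self,
      del_mul_comm_assoc 2 1, del_mul_comm_assoc 2 0,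
      del_mul_comm_assoc 1 0, del_mul_self_assoc, mul_neg, neg_neg, mul_zero]
    simp
  | succ m _ ih => rw [extPow_succ, ih, Submodule.mul_bot]

theorem schouten_schouten (U : MultiVec 3) :
    schouten spBivector (schouten spBivector U) = 0 := by
  induction U using TensorProduct.induction_on with
  | zero => simp
  | add x y hx hy => rw [map_add, map_add, hx, hy, add_zero]
  | tmul f u =>
    -- The grading of the exterior algebra reduces a pure tensor to one with homogeneous second
    -- factor, where the component formulas apply.
    have hu : u ∈ ⨆ m : ℕ, ⋀[ℝ]^m (Fin 3 → ℝ) := by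
      rw [(DirectSum.Decomposition.isInternal
        (fun m : ℕ => ⋀[ℝ]^m (Fin 3 → ℝ))).submodule_iSup_eq_top]
      trivial
    induction hu using Submodule.iSup_induction' with
    | zero => simp
    | add x y _ _ hx hy => rw [TensorProduct.tmul_add, map_add, map_add, hx, hy, add_zero]
    | mem m u hu =>
      match m, hu with
      | 0, hu =>
        rw [ExteriorAlgebra.exteriorPower, pow_zero] at hu
        obtain ⟨a, rfl⟩ := Submodule.mem_one.mp hu
        have := schouten_schouten_fun0 (a • f)
        rwa [fun0_apply, TensorProduct.smul_tmul, ← Algebra.algebraMap_eq_smul_one] at this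
      | 1, hu =>
        obtain ⟨a, b, c, rfl⟩ := exists_of_mem_extPow_one hu
        have := schouten_schouten_vec1 (a • f) (b • f) (c • f)
        simp only [vec1_apply, TensorProduct.smul_tmul, ← TensorProduct.tmul_add] at this
        rwa [← add_assoc] at this
      | 2, hu =>
        obtain ⟨a, b, c, rfl⟩ := exists_of_mem_extPow_two hu
        have := schouten_schouten_vec2 (a • f) (b • f) (c • f)
        simp only [vec2_apply, TensorProduct.smul_tmul, ← TensorProduct.tmul_add] at this
        rwa [← add_assoc] at this
      | 3, hu =>
        obtain ⟨a, rfl⟩ := exists_of_mem_extPow_three hu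
        have := schouten_vec3 (a • f)
        rw [vec3_apply, TensorProduct.smul_tmul] at this
        rw [this, map_zero]
      | m + 4, hu =>
        rw [extPow_eq_bot (by omega), Submodule.mem_bot] at hu
        simp [hu]

end

/-! ### Identification with the Lie–Poisson structure of the symplectic Lie algebra. -/

section

open LieAlgebra.Symplectic

/-- For two-by-two matrices the symplectic condition reduces to vanishing trace. -/
theorem mem_sp_one_iff (A : Matrix (Fin 1 ⊕ Fin 1) (Fin 1 ⊕ Fin 1) ℝ) :
    A ∈ sp (Fin 1) ℝ ↔ A (.inr 0) (.inr 0) = -A (.inl 0) (.inl 0) := by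
  rw [sp, mem_skewAdjointMatricesLieSubalgebra, mem_skewAdjointMatricesSubmodule,
    Matrix.IsSkewAdjoint, Matrix.IsAdjointPair, Matrix.J, ← Matrix.ext_iff]
  simp [Matrix.mul_apply, Fintype.sum_sum_type]
  exact Eq.symm

/-- The coordinates of `[[c, a], [b, -c]]` are `a, b, c`. -/
def spEquiv : sp (Fin 1) ℝ ≃ₗ[ℝ] (Fin 3 → ℝ) where
  toFun A := ![A.1 (.inl 0) (.inr 0), A.1 (.inr 0) (.inl 0), A.1 (.inl 0) (.inl 0)]
  invFun v := ⟨Matrix.fromBlocks !![v 2] !![v 0] !![v 1] !![-v 2], by simp [mem_sp_one_iff]⟩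
  map_add' A B := by ext i; fin_cases i <;> simp
  map_smul' r A := by ext i; fin_cases i <;> simp
  left_inv A := by
    have h := (mem_sp_one_iff A.1).mp A.2
    ext i j
    rcases i with i | i <;> rcases j with j | j <;>
      rw [Subsingleton.elim i 0, Subsingleton.elim j 0] <;> simp [h]
  right_inv v := by ext i; fin_cases i <;> simp

/-- The basis `E, F, H` of `𝔰𝔭(ℝ²)`. -/
def spBasis : Module.Basis (Fin 3) ℝ (sp (Fin 1) ℝ) := .ofEquivFun spEquiv

theorem spBasis_repr_lie (i j k : Fin 3) : spBasis.repr ⁅spBasis i, spBasis j⁆ k =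
    spEquiv ⁅spEquiv.symm (Pi.single i 1), spEquiv.symm (Pi.single j 1)⁆ k := by
  simp [spBasis]

/-- The relations `[H, E] = 2E`, `[H, F] = -2F`, `[E, F] = H` are the prescribed brackets of `z, x,
y`. The factor one half compensates for each pair of indices occurring in both orders. -/
theorem liePoisson_spBasis : liePoisson spBasis = spBivector := by
  simp only [liePoisson, spBasis_repr_lie, Fin.sum_univ_three]
  simp [spEquiv, Ring.lie_def, Matrix.mul_apply, Fintype.sum_sum_type]
  rw [del_mul_comm 0 2, del_mul_comm 1 0, del_mul_comm 1 2, spBivector,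
    show ((-1 - 1) * MvPolynomial.X 0 : Poly3) = -(2 * MvPolynomial.X 0) by ring,
    show ((-1 - 1) * MvPolynomial.X 1 : Poly3) = -(2 * MvPolynomial.X 1) by ring, one_add_one_eq_two]
  simp only [TensorProduct.tmul_neg, TensorProduct.neg_tmul]
  module

end

/-! ### Cochain spaces of given weight, their dimensions, and the invariants. -/

section

open MvPolynomial

/-- For a linear Poisson structure `h = 1`, so the shift `(h - 1) m` vanishes and the supremum has a
single term. -/
theorem cochain_eq (m w : ℕ) : cochain 3 1 m (w : ℤ) = homogPart 3 m w := by
  apply le_antisymm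
  · refine iSup_le fun ⟨p, hp⟩ => ?_
    obtain rfl : p = w := by simpa using hp
    rfl
  · exact le_iSup_of_le ⟨w, by simp⟩ le_rfl

theorem cochain_eq_bot_of_neg (m : ℕ) {w : ℤ} (hw : w < 0) : cochain 3 1 m w = ⊥ := by
  refine iSup_eq_bot.mpr fun ⟨p, hp⟩ => ?_
  simp at hp
  omega

theorem homogPart_eq_span (m w : ℕ) : homogPart 3 m w = Submodule.span ℝ
    {t | ∃ f : Poly3, f.IsHomogeneous w ∧ ∃ u ∈ ⋀[ℝ]^m (Fin 3 → ℝ), f ⊗ₜ[ℝ] u = t} :=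
  (TensorProduct.range_mapIncl _ _).trans (Submodule.map₂_eq_span_image2 _ _ _)

theorem tmul_mem_homogPart {m w : ℕ} {f : Poly3} (hf : f.IsHomogeneous w) {u : Ext3}
    (hu : u ∈ ⋀[ℝ]^m (Fin 3 → ℝ)) : f ⊗ₜ[ℝ] u ∈ homogPart 3 m w := by
  rw [homogPart_eq_span]
  exact Submodule.subset_span ⟨f, hf, u, hu, rfl⟩

abbrev Hom3 (w : ℕ) : Submodule ℝ Poly3 := homogeneousSubmodule (Fin 3) ℝ w

/-- The inclusion of triples of homogeneous polynomials. -/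
def homIncl (w : ℕ) : Hom3 w × Hom3 w × Hom3 w →ₗ[ℝ] Poly3 × Poly3 × Poly3 :=
  (Hom3 w).subtype.prodMap ((Hom3 w).subtype.prodMap (Hom3 w).subtype)

theorem homIncl_injective (w : ℕ) : Function.Injective (homIncl w) :=
  Function.Injective.prodMap Subtype.val_injective
    (Function.Injective.prodMap Subtype.val_injective Subtype.val_injective)

theorem mem_range_comp_homIncl {w : ℕ} (F : Poly3 × Poly3 × Poly3 →ₗ[ℝ] MultiVec 3)
    {U : MultiVec 3} : U ∈ LinearMap.range (F ∘ₗ homIncl w) ↔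
      ∃ a b c : Poly3, a.IsHomogeneous w ∧ b.IsHomogeneous w ∧ c.IsHomogeneous w ∧
        F (a, b, c) = U := by
  constructor
  · rintro ⟨⟨a, b, c⟩, rfl⟩
    exact ⟨a, b, c, a.2, b.2, c.2, rfl⟩
  · rintro ⟨a, b, c, ha, hb, hc, rfl⟩
    exact ⟨(⟨a, ha⟩, ⟨b, hb⟩, ⟨c, hc⟩), rfl⟩

theorem cochain_zero (w : ℕ) :
    cochain 3 1 0 (w : ℤ) = LinearMap.range (fun0 ∘ₗ (Hom3 w).subtype) := by
  rw [cochain_eq]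
  apply le_antisymm
  · rw [homogPart_eq_span, Submodule.span_le]
    rintro _ ⟨f, hf, u, hu, rfl⟩
    rw [ExteriorAlgebra.exteriorPower, pow_zero] at hu
    obtain ⟨a, rfl⟩ := Submodule.mem_one.mp hu
    refine ⟨⟨a • f, (Hom3 w).smul_mem a hf⟩, ?_⟩
    change fun0 (a • f) = _
    rw [fun0_apply, TensorProduct.smul_tmul, ← Algebra.algebraMap_eq_smul_one]
  · rintro _ ⟨f, rfl⟩
    exact tmul_mem_homogPart f.2 (by simp [ExteriorAlgebra.exteriorPower])

theorem cochain_one (w : ℕ) : cochain 3 1 1 (w : ℤ) = LinearMap.range (vec1 ∘ₗ homIncl w) := by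
  rw [cochain_eq]
  apply le_antisymm
  · rw [homogPart_eq_span, Submodule.span_le]
    rintro _ ⟨f, hf, u, hu, rfl⟩
    obtain ⟨a, b, c, rfl⟩ := exists_of_mem_extPow_one hu
    refine (mem_range_comp_homIncl _).mpr ⟨a • f, b • f, c • f, (Hom3 w).smul_mem a hf,
      (Hom3 w).smul_mem b hf, (Hom3 w).smul_mem c hf, ?_⟩
    simp only [vec1_apply, TensorProduct.smul_tmul, ← TensorProduct.tmul_add, add_assoc]
  · intro U hU
    obtain ⟨a, b, c, ha, hb, hc, rfl⟩ := (mem_range_comp_homIncl _).mp hU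
    exact add_mem (tmul_mem_homogPart ha (del_mem 0))
      (add_mem (tmul_mem_homogPart hb (del_mem 1)) (tmul_mem_homogPart hc (del_mem 2)))

theorem del_mul_del_mem (i j : Fin 3) : (del i * del j : Ext3) ∈ ⋀[ℝ]^2 (Fin 3 → ℝ) := by
  rw [extPow_succ 1]
  exact Submodule.mul_mem_mul (del_mem i) (del_mem j)

theorem cochain_two (w : ℕ) : cochain 3 1 2 (w : ℤ) = LinearMap.range (vec2 ∘ₗ homIncl w) := by
  rw [cochain_eq]
  apply le_antisymm
  · rw [homogPart_eq_span, Submodule.span_le]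
    rintro _ ⟨f, hf, u, hu, rfl⟩
    obtain ⟨a, b, c, rfl⟩ := exists_of_mem_extPow_two hu
    refine (mem_range_comp_homIncl _).mpr ⟨a • f, b • f, c • f, (Hom3 w).smul_mem a hf,
      (Hom3 w).smul_mem b hf, (Hom3 w).smul_mem c hf, ?_⟩
    simp only [vec2_apply, TensorProduct.smul_tmul, ← TensorProduct.tmul_add, add_assoc]
  · intro U hU
    obtain ⟨a, b, c, ha, hb, hc, rfl⟩ := (mem_range_comp_homIncl _).mp hU
    exact add_mem (tmul_mem_homogPart ha (del_mul_del_mem 1 2))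
      (add_mem (tmul_mem_homogPart hb (del_mul_del_mem 2 0))
        (tmul_mem_homogPart hc (del_mul_del_mem 0 1)))

theorem cochain_three (w : ℕ) :
    cochain 3 1 3 (w : ℤ) = LinearMap.range (vec3 ∘ₗ (Hom3 w).subtype) := by
  rw [cochain_eq]
  apply le_antisymm
  · rw [homogPart_eq_span, Submodule.span_le]
    rintro _ ⟨f, hf, u, hu, rfl⟩
    obtain ⟨a, rfl⟩ := exists_of_mem_extPow_three hu
    refine ⟨⟨a • f, (Hom3 w).smul_mem a hf⟩, ?_⟩
    change vec3 (a • f) = _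
    rw [vec3_apply, TensorProduct.smul_tmul]
  · rintro _ ⟨f, rfl⟩
    refine tmul_mem_homogPart f.2 ?_
    rw [extPow_succ 2]
    exact Submodule.mul_mem_mul (del_mem 0) (del_mul_del_mem 1 2)

theorem cochain_eq_bot {m : ℕ} (hm : 3 < m) (w : ℤ) : cochain 3 1 m w = ⊥ := by
  rcases lt_or_ge w 0 with hw | hw
  · exact cochain_eq_bot_of_neg m hw
  lift w to ℕ using hw
  rw [cochain_eq, homogPart_eq_span, eq_bot_iff, Submodule.span_le]
  rintro _ ⟨f, hf, u, hu, rfl⟩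
  rw [extPow_eq_bot hm, Submodule.mem_bot] at hu
  simp [hu]

theorem finrank_hom3 (w : ℕ) : Module.finrank ℝ (Hom3 w) = (2 + w).choose 2 :=
  finrank_homogeneousSubmodule 2 w

theorem finrank_hom3_prod (w : ℕ) :
    Module.finrank ℝ (Hom3 w × Hom3 w × Hom3 w) = 3 * (2 + w).choose 2 := by
  rw [Module.finrank_prod, Module.finrank_prod, finrank_hom3]
  ring

theorem finrank_cochain_zero (w : ℕ) :
    Module.finrank ℝ (cochain 3 1 0 (w : ℤ)) = (2 + w).choose 2 := by
  have h : Function.Injective (fun0 ∘ₗ (Hom3 w).subtype) :=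
    fun0_injective.comp Subtype.val_injective
  rw [cochain_zero, LinearMap.finrank_range_of_inj h, finrank_hom3]

theorem finrank_cochain_one (w : ℕ) :
    Module.finrank ℝ (cochain 3 1 1 (w : ℤ)) = 3 * (2 + w).choose 2 := by
  have h : Function.Injective (vec1 ∘ₗ homIncl w) := vec1_injective.comp (homIncl_injective w)
  rw [cochain_one, LinearMap.finrank_range_of_inj h, finrank_hom3_prod]

theorem finrank_cochain_two (w : ℕ) :
    Module.finrank ℝ (cochain 3 1 2 (w : ℤ)) = 3 * (2 + w).choose 2 := by
  have h : Function.Injective (vec2 ∘ₗ homIncl w) := vec2_injective.comp (homIncl_injective w)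
  rw [cochain_two, LinearMap.finrank_range_of_inj h, finrank_hom3_prod]

theorem finrank_cochain_three (w : ℕ) :
    Module.finrank ℝ (cochain 3 1 3 (w : ℤ)) = (2 + w).choose 2 := by
  have h : Function.Injective (vec3 ∘ₗ (Hom3 w).subtype) :=
    vec3_injective.comp Subtype.val_injective
  rw [cochain_three, LinearMap.finrank_range_of_inj h, finrank_hom3]

/-- Rank-nullity for `finrank`, whose default value on infinite-dimensional spaces is zero, relies
on this. -/
instance finite_cochain (m w : ℕ) : Module.Finite ℝ (cochain 3 1 m (w : ℤ)) := by
  match m with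
  | 0 => rw [cochain_zero]; infer_instance
  | 1 => rw [cochain_one]; infer_instance
  | 2 => rw [cochain_two]; infer_instance
  | 3 => rw [cochain_three]; infer_instance
  | m + 4 => rw [cochain_eq_bot (by omega)]; infer_instance

theorem two_mul_mem {w : ℕ} {f : Poly3} (hf : f.IsHomogeneous w) : (2 * f).IsHomogeneous w := by
  rw [← C_two]
  exact hf.C_mul 2

theorem map_schouten_cochain_le (m : ℕ) (w : ℤ) :
    (cochain 3 1 m w).map (schouten spBivector) ≤ cochain 3 1 (m + 1) w := by
  rcases lt_or_ge w 0 with hw | hw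
  · simp [cochain_eq_bot_of_neg m hw]
  lift w to ℕ using hw
  rw [Submodule.map_le_iff_le_comap]
  intro U hU
  rw [Submodule.mem_comap]
  match m, hU with
  | 0, hU =>
    rw [cochain_zero] at hU
    obtain ⟨f, rfl⟩ := hU
    rw [zero_add, cochain_one, mem_range_comp_homIncl]
    exact ⟨_, _, _, hamX_mem f.2, hamY_mem f.2, hamZ_mem f.2, (schouten_fun0 f).symm⟩
  | 1, hU =>
    rw [cochain_one, mem_range_comp_homIncl] at hU
    obtain ⟨a, b, c, ha, hb, hc, rfl⟩ := hU
    rw [one_add_one_eq_two, cochain_two, mem_range_comp_homIncl]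
    exact ⟨_, _, _, ((hamY_mem hc).sub (hamZ_mem hb)).sub (two_mul_mem hb),
      ((hamZ_mem ha).sub (hamX_mem hc)).sub (two_mul_mem ha),
      ((hamX_mem hb).sub (hamY_mem ha)).sub hc, (schouten_vec1 a b c).symm⟩
  | 2, hU =>
    rw [cochain_two, mem_range_comp_homIncl] at hU
    obtain ⟨a, b, c, ha, hb, hc, rfl⟩ := hU
    rw [schouten_vec2, show 2 + 1 = 3 from rfl, cochain_three]
    exact ⟨⟨_, ((hamX_mem ha).add (hamY_mem hb)).add (hamZ_mem hc)⟩, rfl⟩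
  | 3, hU =>
    rw [cochain_three] at hU
    obtain ⟨f, rfl⟩ := hU
    rw [LinearMap.comp_apply, schouten_vec3]
    exact zero_mem _
  | m + 4, hU =>
    rw [cochain_eq_bot (by omega), Submodule.mem_bot] at hU
    rw [hU, map_zero]
    exact zero_mem _

/-- Casimir invariants: the kernel in degree `0` has dimension `1` in even weights. -/
theorem finrank_cocycles_zero (w : ℕ) :
    Module.finrank ℝ (cocycles spBivector 1 0 (w : ℤ)) = if Even w then 1 else 0 := by
  have key : ∀ f : Poly3, schouten spBivector (fun0 f) = 0 ↔
      hamX f = 0 ∧ hamY f = 0 ∧ hamZ f = 0 := fun f => by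
    rw [schouten_fun0, ← map_zero vec1, vec1_injective.eq_iff]
    simp [Prod.ext_iff]
  split_ifs with hw
  · obtain ⟨k, rfl⟩ := even_iff_exists_two_mul.mp hw
    have : cocycles spBivector 1 0 ((2 * k : ℕ) : ℤ) =
        Submodule.span ℝ {fun0 (casimirPoly ^ k)} := by
      rw [cocycles, cochain_zero]
      ext U
      rw [Submodule.mem_span_singleton]
      constructor
      · rintro ⟨⟨f, rfl⟩, hU⟩
        obtain ⟨hx, hy, hz⟩ := (key f).mp hU
        -- An invariant is killed by the Casimir operator, and in this degree only multiples of
        -- `q^k` are.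
        obtain ⟨-, e, he⟩ := cas_eq_even (c := 0) f.2
          (by simpa using cas_eq_zero_of_ham_eq_zero hx hy hz)
        refine ⟨e, ?_⟩
        rw [LinearMap.comp_apply, Submodule.subtype_apply, he, ← map_smul, smul_eq_C_mul]
      · rintro ⟨e, rfl⟩
        refine Submodule.smul_mem _ _ ⟨⟨⟨casimirPoly ^ k, isHomogeneous_casimirPoly.pow k⟩, rfl⟩, ?_⟩
        refine (key _).mpr ⟨?_, ?_, ?_⟩
        · simpa using ham_casimirPoly_pow _ hamX_casimirPoly k 1
        · simpa using ham_casimirPoly_pow _ hamY_casimirPoly k 1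
        · simpa using ham_casimirPoly_pow _ hamZ_casimirPoly k 1
    rw [this, finrank_span_singleton]
    rw [Ne, map_eq_zero_iff _ fun0_injective]
    exact pow_ne_zero _ casimirPoly_ne_zero
  · obtain ⟨k, rfl⟩ := Nat.not_even_iff_odd.mp hw
    have : cocycles spBivector 1 0 ((2 * k + 1 : ℕ) : ℤ) = ⊥ := by
      rw [cocycles, cochain_zero, eq_bot_iff]
      rintro _ ⟨⟨f, rfl⟩, hU⟩
      obtain ⟨hx, hy, hz⟩ := (key f).mp hU
      have := eq_zero_of_cas_eq_zero_odd f.2 (cas_eq_zero_of_ham_eq_zero hx hy hz)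
      simp [this]
    rw [this, finrank_bot]

end

/-! ### Exactness in degrees one and two, and the Betti numbers. -/

section

open MvPolynomial

/-- Centrality of the Casimir element, obtained by reordering products with the `sl₂` relations. It
lets `cas` be pulled out of the cocycle equations. -/
theorem ham_cas_comm (f : Poly3) :
    hamX (cas f) = cas (hamX f) ∧ hamY (cas f) = cas (hamY f) ∧ hamZ (cas f) = cas (hamZ f) := by
  have hc : (2 : Poly3) * C (1 / 2) = 1 := by rw [← C_two, ← C_mul]; norm_num
  have hC : ∀ (D : Derivation ℝ Poly3 Poly3) (r : ℝ) (g : Poly3), D (C r * g) = C r * D g :=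
    fun D r g => by simp [Derivation.leibniz]
  have h2 : ∀ (D : Derivation ℝ Poly3 Poly3) (g : Poly3), D (2 * g) = 2 * D g :=
    fun D g => by rw [← C_two, hC]
  simp only [cas_apply, map_add, hC]
  refine ⟨?_, ?_, ?_⟩
  · simp only [hamX_hamY, hamZ_hamX, map_add, h2]
    linear_combination (-2 * hamX (hamZ f) - 2 * hamX f) * hc
  · simp only [hamX_hamY, hamZ_hamY, map_add, map_sub, h2]
    linear_combination (2 * hamY (hamZ f) - 2 * hamY f) * hc
  · simp only [hamX_hamY, hamZ_hamX, hamZ_hamY, map_add, h2]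
    ring

theorem cas_two_mul (f : Poly3) : cas (2 * f) = 2 * cas f := by
  rw [← C_two, ← smul_eq_C_mul, ← smul_eq_C_mul, map_smul]

/-- A sum of an invariant and a value of the Casimir operator vanishes only if both do. -/
theorem eq_zero_of_add_cas_eq_zero {w : ℕ} {s t : Poly3} (ht : t.IsHomogeneous w)
    (hs : cas s = 0) (h : s + cas t = 0) :
    s = 0 ∧ hamX t = 0 ∧ hamY t = 0 ∧ hamZ t = 0 := by
  have h1 : cas t = 0 := by
    refine cas_eq_zero_of_cas_cas_eq_zero ht ?_
    have := congrArg cas h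
    rwa [map_add, hs, zero_add, map_zero] at this
  rw [h1, add_zero] at h
  exact ⟨h, ham_eq_zero_of_cas_eq_zero ht h1⟩

/-- Each component is split as an invariant plus `cas` of a primed polynomial. The cocycle equations
then split as well: the invariant parts vanish, and the differential of the primed triple has
invariant components. On such a triple the homotopy formula has no `h d` term left after the
Hamiltonian derivations are applied. -/
theorem exact_one {w : ℕ} {a b c : Poly3} (ha : a.IsHomogeneous w) (hb : b.IsHomogeneous w)
    (hc : c.IsHomogeneous w) (hx : hamY c - hamZ b - 2 * b = 0)
    (hy : hamZ a - hamX c - 2 * a = 0) (hz : hamX b - hamY a - c = 0) :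
    ∃ f : Poly3, f.IsHomogeneous w ∧ hamX f = a ∧ hamY f = b ∧ hamZ f = c := by
  obtain ⟨a₀, a', ha₀, ha', ca, rfl⟩ := exists_eq_add_cas ha
  obtain ⟨b₀, b', hb₀, hb', cb, rfl⟩ := exists_eq_add_cas hb
  obtain ⟨c₀, c', hc₀, hc', cc, rfl⟩ := exists_eq_add_cas hc
  have hhalf : (2 : Poly3) * C (1 / 2) = 1 := by rw [← C_two, ← C_mul]; norm_num
  obtain ⟨-, a2, a3⟩ := ham_eq_zero_of_cas_eq_zero ha₀ ca
  obtain ⟨b1, -, b3⟩ := ham_eq_zero_of_cas_eq_zero hb₀ cb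
  obtain ⟨c1, c2, -⟩ := ham_eq_zero_of_cas_eq_zero hc₀ cc
  simp only [map_add, a2, a3, b1, b3, c1, c2, zero_add, (ham_cas_comm _).1,
    (ham_cas_comm _).2.1, (ham_cas_comm _).2.2] at hx hy hz
  -- On invariants only the bracket terms of the differential survive, so the three equations
  -- isolate `-2 b₀`, `-2 a₀` and `-c₀` in turn.
  obtain ⟨hb0, x1, x2, x3⟩ := eq_zero_of_add_cas_eq_zero (w := w) (s := -(2 * b₀))
    (t := hamY c' - hamZ b' - 2 * b') (((hamY_mem hc').sub (hamZ_mem hb')).sub (two_mul_mem hb'))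
    (by rw [map_neg, cas_two_mul, cb]; simp)
    (by simp only [map_sub, cas_two_mul]; linear_combination hx)
  obtain ⟨ha0, y1, y2, y3⟩ := eq_zero_of_add_cas_eq_zero (w := w) (s := -(2 * a₀))
    (t := hamZ a' - hamX c' - 2 * a') (((hamZ_mem ha').sub (hamX_mem hc')).sub (two_mul_mem ha'))
    (by rw [map_neg, cas_two_mul, ca]; simp)
    (by simp only [map_sub, cas_two_mul]; linear_combination hy)
  obtain ⟨hc0, z1, z2, z3⟩ := eq_zero_of_add_cas_eq_zero (w := w) (s := -c₀)
    (t := hamX b' - hamY a' - c') (((hamX_mem hb').sub (hamY_mem ha')).sub hc')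
    (by rw [map_neg, cc]; simp)
    (by simp only [map_sub]; linear_combination hz)
  have ha0 : a₀ = 0 := by simpa using ha0
  have hb0 : b₀ = 0 := by simpa using hb0
  have hc0 : c₀ = 0 := by simpa using hc0
  have hC : ∀ (D : Derivation ℝ Poly3 Poly3) (g : Poly3), D (C (1 / 2) * g) = C (1 / 2) * D g :=
    fun D g => by simp [Derivation.leibniz]
  have h2 : ∀ (D : Derivation ℝ Poly3 Poly3) (g : Poly3), D (2 * g) = 2 * D g :=
    fun D g => by simp [two_mul]
  simp only [map_sub, h2] at x1 x2 x3 y1 y2 y3 z1 z2 z3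
  -- The primitive is the homotopy applied to the primed triple: contraction with the dual basis for
  -- the form defining `cas`, which pairs `x` with `y` and `z` with `z / 2`.
  refine ⟨hamX b' + hamY a' + C (1 / 2) * hamZ c', ((hamX_mem hb').add (hamY_mem ha')).add
    ((hamZ_mem hc').C_mul _), ?_, ?_, ?_⟩
  · simp only [ha0, map_add, hC, cas_apply]
    linear_combination z1 - C (1 / 2) * y3 + hamX_hamY a' - C (1 / 2) * hamZ_hamX c'
      - (hamZ a' + hamX c') * hhalf
  · simp only [hb0, map_add, hC, cas_apply]
    linear_combination -z2 + C (1 / 2) * x3 - C (1 / 2) * hamZ_hamY c' - hamX_hamY b'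
      + (hamY c' + hamZ b') * hhalf
  · simp only [hc0, map_add, hC, cas_apply]
    linear_combination y2 - x1 + hamZ_hamX b' + hamZ_hamY a'

/-- The cocycle equation makes the divergence of the primed triple invariant, so the homotopy gives
a primitive of the `cas` parts. The invariant parts are themselves boundaries. -/
theorem exact_two {w : ℕ} {p q r : Poly3} (hp : p.IsHomogeneous w) (hq : q.IsHomogeneous w)
    (hr : r.IsHomogeneous w) (h : hamX p + hamY q + hamZ r = 0) :
    ∃ a b c : Poly3, a.IsHomogeneous w ∧ b.IsHomogeneous w ∧ c.IsHomogeneous w ∧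
      hamY c - hamZ b - 2 * b = p ∧ hamZ a - hamX c - 2 * a = q ∧ hamX b - hamY a - c = r := by
  obtain ⟨p₀, p', hp₀, hp', cp, rfl⟩ := exists_eq_add_cas hp
  obtain ⟨q₀, q', hq₀, hq', cq, rfl⟩ := exists_eq_add_cas hq
  obtain ⟨r₀, r', hr₀, hr', cr, rfl⟩ := exists_eq_add_cas hr
  have hhalf : (2 : Poly3) * C (1 / 2) = 1 := by rw [← C_two, ← C_mul]; norm_num
  obtain ⟨p1, p2, p3⟩ := ham_eq_zero_of_cas_eq_zero hp₀ cp
  obtain ⟨q1, q2, q3⟩ := ham_eq_zero_of_cas_eq_zero hq₀ cq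
  obtain ⟨r1, r2, r3⟩ := ham_eq_zero_of_cas_eq_zero hr₀ cr
  simp only [map_add, p1, q2, r3, zero_add, (ham_cas_comm _).1,
    (ham_cas_comm _).2.1, (ham_cas_comm _).2.2] at h
  obtain ⟨-, x1, x2, x3⟩ := eq_zero_of_add_cas_eq_zero (w := w) (s := 0)
    (t := hamX p' + hamY q' + hamZ r') (((hamX_mem hp').add (hamY_mem hq')).add (hamZ_mem hr'))
    (map_zero _) (by simp only [map_add]; linear_combination h)
  have hC : ∀ (D : Derivation ℝ Poly3 Poly3) (g : Poly3), D (C (1 / 2) * g) = C (1 / 2) * D g :=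
    fun D g => by simp [Derivation.leibniz]
  simp only [map_add] at x1 x2 x3
  -- The derivative terms are the homotopy in degree two. The corrections invert `(a, b, c) ↦ (-2b,
  -- -2a, -c)`, the differential on invariant triples, which is why `q₀` enters the first component
  -- and `p₀` the second.
  refine ⟨C (1 / 2) * hamZ q' - hamX r' - C (1 / 2) * q₀, hamY r' - C (1 / 2) * hamZ p'
    - C (1 / 2) * p₀, hamX p' - hamY q' - r₀,
    (((hamZ_mem hq').C_mul _).sub (hamX_mem hr')).sub (hq₀.C_mul _),
    ((hamY_mem hr').sub ((hamZ_mem hp').C_mul _)).sub (hp₀.C_mul _),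
    ((hamX_mem hp').sub (hamY_mem hq')).sub hr₀, ?_, ?_, ?_⟩
  · simp only [map_sub, hC, cas_apply, p3, r2]
    linear_combination -x2 - hamX_hamY p' - hamZ_hamY r' + (hamZ p' + p₀) * hhalf
  · simp only [map_sub, hC, cas_apply, q3, r1]
    linear_combination -x1 - hamZ_hamX r' + hamX_hamY q' + (q₀ - hamZ q') * hhalf
  · simp only [map_sub, hC, cas_apply, p1, q2]
    linear_combination -C (1 / 2) * x3 + C (1 / 2) * hamZ_hamX p' + C (1 / 2) * hamZ_hamY q'
      + (hamX p' - hamY q') * hhalf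

theorem coboundaries_le_cocycles (m w : ℕ) :
    coboundaries spBivector 1 m (w : ℤ) ≤ cocycles spBivector 1 m (w : ℤ) := by
  match m with
  | 0 => exact bot_le
  | m + 1 =>
    refine le_inf (map_schouten_cochain_le m w) ?_
    rintro _ ⟨U, -, rfl⟩
    exact schouten_schouten U

theorem cocycles_one_eq (w : ℕ) :
    cocycles spBivector 1 1 (w : ℤ) = coboundaries spBivector 1 1 (w : ℤ) := by
  apply le_antisymm
  · rintro U ⟨hU, hd⟩
    rw [SetLike.mem_coe, cochain_one, mem_range_comp_homIncl] at hU
    obtain ⟨a, b, c, ha, hb, hc, rfl⟩ := hU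
    rw [SetLike.mem_coe, LinearMap.mem_ker, schouten_vec1, ← map_zero vec2,
      vec2_injective.eq_iff, Prod.ext_iff, Prod.ext_iff] at hd
    obtain ⟨f, hf, rfl, rfl, rfl⟩ := exact_one ha hb hc hd.1 hd.2.1 hd.2.2
    refine ⟨fun0 f, ?_, schouten_fun0 f⟩
    rw [SetLike.mem_coe, cochain_zero]
    exact ⟨⟨f, hf⟩, rfl⟩
  · exact coboundaries_le_cocycles 1 w

theorem cocycles_two_eq (w : ℕ) :
    cocycles spBivector 1 2 (w : ℤ) = coboundaries spBivector 1 2 (w : ℤ) := by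
  apply le_antisymm
  · rintro U ⟨hU, hd⟩
    rw [SetLike.mem_coe, cochain_two, mem_range_comp_homIncl] at hU
    obtain ⟨p, q, r, hp, hq, hr, rfl⟩ := hU
    rw [SetLike.mem_coe, LinearMap.mem_ker, schouten_vec2, ← map_zero vec3,
      vec3_injective.eq_iff] at hd
    obtain ⟨a, b, c, ha, hb, hc, rfl, rfl, rfl⟩ := exact_two hp hq hr hd
    refine ⟨vec1 (a, b, c), ?_, schouten_vec1 a b c⟩
    rw [SetLike.mem_coe, cochain_one, mem_range_comp_homIncl]
    exact ⟨a, b, c, ha, hb, hc, rfl⟩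
  · exact coboundaries_le_cocycles 2 w

theorem cocycles_three_eq (w : ℕ) :
    cocycles spBivector 1 3 (w : ℤ) = cochain 3 1 3 (w : ℤ) := by
  rw [cocycles, inf_eq_left, cochain_three]
  rintro _ ⟨f, rfl⟩
  exact schouten_vec3 _

/-- Rank-nullity for the differential on the cochain space. -/
theorem finrank_coboundaries_succ (m w : ℕ) :
    Module.finrank ℝ (coboundaries spBivector 1 (m + 1) (w : ℤ))
      + Module.finrank ℝ (cocycles spBivector 1 m (w : ℤ))
      = Module.finrank ℝ (cochain 3 1 m (w : ℤ)) := by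
  have h := LinearMap.finrank_range_add_finrank_ker
    ((schouten spBivector).domRestrict (cochain 3 1 m (w : ℤ)))
  rw [← h]
  congr 1
  · rw [coboundaries, LinearMap.range_domRestrict]
  · rw [LinearMap.ker_domRestrict, cocycles, ← Submodule.map_comap_subtype]
    exact (Submodule.equivMapOfInjective _ (Submodule.injective_subtype _) _).symm.finrank_eq

theorem betti_add_finrank_coboundaries (m w : ℕ) :
    betti spBivector 1 m (w : ℤ) + Module.finrank ℝ (coboundaries spBivector 1 m (w : ℤ))
      = Module.finrank ℝ (cocycles spBivector 1 m (w : ℤ)) := by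
  have : Module.Finite ℝ (cocycles spBivector 1 m (w : ℤ)) :=
    Submodule.finiteDimensional_inf_left _ _
  rw [← Submodule.finrank_quotient_add_finrank
    ((coboundaries spBivector 1 m (w : ℤ)).submoduleOf (cocycles spBivector 1 m (w : ℤ)))]
  congr 1
  exact (Submodule.submoduleOfEquivOfLe (coboundaries_le_cocycles m w)).symm.finrank_eq

theorem betti_eq_zero {m : ℕ} (hm : 3 < m) (w : ℕ) : betti spBivector 1 m (w : ℤ) = 0 := by
  have h := betti_add_finrank_coboundaries m w
  rw [cocycles, cochain_eq_bot hm, bot_inf_eq, finrank_bot] at h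
  omega

/-- All dimensions, in terms of the dimension `ε` of the space of invariants. -/
theorem finrank_cocycles_and_betti (w : ℕ) {ε : ℕ} (hε : (if Even w then 1 else 0) = ε) :
    Module.finrank ℝ (cocycles spBivector 1 0 (w : ℤ)) = ε ∧
    Module.finrank ℝ (cocycles spBivector 1 1 (w : ℤ)) + ε = (2 + w).choose 2 ∧
    Module.finrank ℝ (cocycles spBivector 1 2 (w : ℤ)) = 2 * (2 + w).choose 2 + ε ∧
    Module.finrank ℝ (cocycles spBivector 1 3 (w : ℤ)) = (2 + w).choose 2 ∧
    betti spBivector 1 0 (w : ℤ) = ε ∧ betti spBivector 1 1 (w : ℤ) = 0 ∧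
    betti spBivector 1 2 (w : ℤ) = 0 ∧ betti spBivector 1 3 (w : ℤ) = ε := by
  have k0 := finrank_cocycles_zero w
  rw [hε] at k0
  -- Exactness identifies cocycles with coboundaries in degrees one and two, and every trivector is
  -- a cocycle, so rank-nullity is a linear system determining all dimensions from `ε`.
  have r1 := finrank_coboundaries_succ 0 w
  have r2 := finrank_coboundaries_succ 1 w
  have r3 := finrank_coboundaries_succ 2 w
  have b0 := betti_add_finrank_coboundaries 0 w
  have b1 := betti_add_finrank_coboundaries 1 w
  have b2 := betti_add_finrank_coboundaries 2 w
  have b3 := betti_add_finrank_coboundaries 3 w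
  rw [coboundaries, finrank_bot] at b0
  rw [← cocycles_one_eq] at b1
  rw [← cocycles_two_eq] at b2
  have k3 := finrank_cochain_three w
  rw [← cocycles_three_eq] at k3
  rw [zero_add, ← cocycles_one_eq, finrank_cochain_zero] at r1
  rw [one_add_one_eq_two, ← cocycles_two_eq, finrank_cochain_one] at r2
  rw [show 2 + 1 = 3 from rfl, finrank_cochain_two] at r3
  omega

end

end PolyPoisson

end

theorem mainTheorem8 :
    -- the bivector is the Lie–Poisson structure of `𝔰𝔭(ℝ²)` in suitable linear coordinates
    (∃ b : Module.Basis (Fin 3) ℝ (LieAlgebra.Symplectic.sp (Fin 1) ℝ),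
      PolyPoisson.liePoisson b = PolyPoisson.spBivector) ∧
    -- it is a Poisson structure, and it makes the cochain spaces of each weight a complex
    PolyPoisson.schouten PolyPoisson.spBivector PolyPoisson.spBivector = 0 ∧
    (∀ (m : ℕ) (w : ℤ), (PolyPoisson.cochain 3 1 m w).map
      (PolyPoisson.schouten PolyPoisson.spBivector) ≤ PolyPoisson.cochain 3 1 (m + 1) w) ∧
    (∀ U : PolyPoisson.MultiVec 3, PolyPoisson.schouten PolyPoisson.spBivector
      (PolyPoisson.schouten PolyPoisson.spBivector U) = 0) ∧
    -- dimensions of the cochain spaces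
    (∀ w : ℕ,
      Module.finrank ℝ (PolyPoisson.cochain 3 1 0 w) = (2 + w).choose 2 ∧
      Module.finrank ℝ (PolyPoisson.cochain 3 1 1 w) = 3 * (2 + w).choose 2 ∧
      Module.finrank ℝ (PolyPoisson.cochain 3 1 2 w) = 3 * (2 + w).choose 2 ∧
      Module.finrank ℝ (PolyPoisson.cochain 3 1 3 w) = (2 + w).choose 2 ∧
      ∀ m : ℕ, 3 < m → PolyPoisson.cochain 3 1 m w = ⊥) ∧
    -- odd weights: kernel dimensions and Betti numbers
    (∀ w : ℕ, Odd w →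
      Module.finrank ℝ (PolyPoisson.cocycles PolyPoisson.spBivector 1 0 w) = 0 ∧
      Module.finrank ℝ (PolyPoisson.cocycles PolyPoisson.spBivector 1 1 w) = (2 + w).choose 2 ∧
      Module.finrank ℝ (PolyPoisson.cocycles PolyPoisson.spBivector 1 2 w)
        = 2 * (2 + w).choose 2 ∧
      Module.finrank ℝ (PolyPoisson.cocycles PolyPoisson.spBivector 1 3 w) = (2 + w).choose 2 ∧
      PolyPoisson.betti PolyPoisson.spBivector 1 0 w = 0 ∧
      PolyPoisson.betti PolyPoisson.spBivector 1 1 w = 0 ∧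
      PolyPoisson.betti PolyPoisson.spBivector 1 2 w = 0 ∧
      PolyPoisson.betti PolyPoisson.spBivector 1 3 w = 0) ∧
    -- even weights: kernel dimensions and Betti numbers
    (∀ w : ℕ, Even w →
      Module.finrank ℝ (PolyPoisson.cocycles PolyPoisson.spBivector 1 0 w) = 1 ∧
      Module.finrank ℝ (PolyPoisson.cocycles PolyPoisson.spBivector 1 1 w) + 1
        = (2 + w).choose 2 ∧
      Module.finrank ℝ (PolyPoisson.cocycles PolyPoisson.spBivector 1 2 w)
        = 2 * (2 + w).choose 2 + 1 ∧
      Module.finrank ℝ (PolyPoisson.cocycles PolyPoisson.spBivector 1 3 w) = (2 + w).choose 2 ∧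
      PolyPoisson.betti PolyPoisson.spBivector 1 0 w = 1 ∧
      PolyPoisson.betti PolyPoisson.spBivector 1 1 w = 0 ∧
      PolyPoisson.betti PolyPoisson.spBivector 1 2 w = 0 ∧
      PolyPoisson.betti PolyPoisson.spBivector 1 3 w = 1) ∧
    -- periodicity modulo 2 in the weight
    (∀ m w : ℕ, PolyPoisson.betti PolyPoisson.spBivector 1 m ((w + 2 : ℕ) : ℤ)
      = PolyPoisson.betti PolyPoisson.spBivector 1 m w) ∧
    -- the determinant formula and full rank of the auxiliary matrix
    (∀ Ω : ℕ,
      (PolyPoisson.auxMatrix Ω).det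
        = (Ω.factorial : ℝ) * ∑ j ∈ Finset.Icc 1 (Ω + 1),
            (∏ i ∈ Finset.range (j - 1), PolyPoisson.psi Ω i)
              * ∏ i ∈ Finset.Icc j Ω, PolyPoisson.phi Ω i) ∧
    (∀ Ω : ℕ, (PolyPoisson.auxMatrix Ω).rank = 2 * Ω + 1) := by
  have hodd : ∀ w : ℕ, Odd w → (if Even w then 1 else 0) = 0 := fun w hw =>
    if_neg (Nat.not_even_iff_odd.mpr hw)
  have heven : ∀ w : ℕ, Even w → (if Even w then 1 else 0) = 1 := fun w hw => if_pos hw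
  refine ⟨⟨_, PolyPoisson.liePoisson_spBasis⟩, PolyPoisson.schouten_self,
    PolyPoisson.map_schouten_cochain_le, PolyPoisson.schouten_schouten, fun w =>
    ⟨PolyPoisson.finrank_cochain_zero w, PolyPoisson.finrank_cochain_one w,
      PolyPoisson.finrank_cochain_two w, PolyPoisson.finrank_cochain_three w,
      fun m hm => PolyPoisson.cochain_eq_bot hm w⟩,
    fun w hw => PolyPoisson.finrank_cocycles_and_betti w (hodd w hw),
    fun w hw => PolyPoisson.finrank_cocycles_and_betti w (heven w hw), fun m w => ?_,
    PolyPoisson.auxMatrix_det, PolyPoisson.auxMatrix_rank⟩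
  have h1 := PolyPoisson.finrank_cocycles_and_betti w rfl
  -- The Betti numbers depend on the weight only through `ε`, hence only through its parity.
  have h2 := PolyPoisson.finrank_cocycles_and_betti (w + 2)
    (ε := if Even w then 1 else 0) (by simp [Nat.even_add])
  match m with
  | 0 => exact h2.2.2.2.2.1.trans h1.2.2.2.2.1.symm
  | 1 => exact h2.2.2.2.2.2.1.trans h1.2.2.2.2.2.1.symm
  | 2 => exact h2.2.2.2.2.2.2.1.trans h1.2.2.2.2.2.2.1.symm
  | 3 => exact h2.2.2.2.2.2.2.2.trans h1.2.2.2.2.2.2.2.symm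
  | m + 4 => rw [PolyPoisson.betti_eq_zero (by omega), PolyPoisson.betti_eq_zero (by omega)]
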